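/- **Setting.** Let $G$ be a real Banach–Lie group with Banach–Lie algebra $\mathfrak g=T_1G$, and let $K\subset G$ be an embedded Banach–Lie subgroup, i.e. a subgroup which, with the subspace topology, is a Banach–Lie group whose inclusion into $G$ is smooth with differentials that are injective with closed range (the range need not be complemented). Let $\mathfrak k\subset\mathfrak g$ be its Lie algebra, the image of $T_1K$. Suppose that $G/K=\{gK\}$, with the quotient topology, carries a smooth Hausdorff Banach manifold structure for which $\pi:G\to G/K$, $\pi(g)=gK$, is smooth with surjective differential $\pi_{*g}$ at every $g\in G$. Write $p_0=\pi(1)$ and $\alpha_g(\pi(h))=\pi(gh)$, and let $\mathrm{Ad}_g$ be the differential at $1$ of $h\mapsto ghg^{-1}$. A homogeneous almost complex structure on $G/K$ is a smooth vector bundle map $\mathcal J:T(G/K)\to T(G/K)$ over the identity such that $\mathcal J^2=-1$ and $(\alpha_g)_*\mathcal J_p=\mathcal J_{\alpha_g(p)}(\alpha_g)_*$ for all $g\in G$, $p\in G/K$. Let $J:\mathfrak g\to\mathfrak g$ be a bounded linear operator such that $J\mathfrak k\subset\mathfrak k$, $\mathrm{Ran}(\mathrm{Ad}_kJ-J\,\mathrm{Ad}_k)\subset\mathfrak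 k$ for all $k\in K$, and $\mathrm{Ran}(J^2+1)\subset\mathfrak k$. A bundle map $\mathcal J$ is induced by $J$ if $\mathcal J_{p_0}\pi_{*1}v=\pi_{*1}Jv$ for all $v\in\mathfrak g$, and $\mathcal J_{\alpha_g(p_0)}=(\alpha_g)_*\mathcal J_{p_0}(\alpha_g)_*^{-1}$ for all $g\in G$. Let $\mathfrak g^{\mathbb C}$, $\mathfrak k^{\mathbb C}$, $J^{\mathbb C}$ be the complexifications of $\mathfrak g$, $\mathfrak k$, $J$, and $$Z_+=\{v\in\mathfrak g^{\mathbb C}: (J^{\mathbb C}-i)v\in\mathfrak k^{\mathbb C}\}.$$ **Theorem.** Let $\mathcal J$ be a homogeneous almost complex structure on $G/K$ induced by such a $J$. Then the Nijenhuis torsion $$\Omega_{\mathcal J}(X,Y)=\mathcal J[\mathcal JX,Y]+\mathcal J[X,\mathcal JY]-[\mathcal JX,\mathcal JY]-\mathcal J^2[X,Y]$$ vanishes for all smooth vector fields $X,Y$ on $G/K$ if and only if $[v,w]\in Z_+$ for all $v,w\in Z_+$. -/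

import Mathlib

open scoped Manifold ContDiff TensorProduct

noncomputable section

/-- A `C^∞` Lie group is in particular regular enough for Mathlib's Lie algebra structure on its
tangent space at the identity. -/
instance lieGroupMinSmoothnessOfSmooth {E : Type*} [NormedAddCommGroup E] [NormedSpace ℝ E]
    {G : Type*} [TopologicalSpace G] [ChartedSpace E G] [Group G] [LieGroup 𝓘(ℝ, E) ∞ G] :
    LieGroup 𝓘(ℝ, E) (minSmoothness ℝ 3) G :=
  LieGroup.of_le (n := ∞) (by
    rw [minSmoothness_of_isRCLikeNormedField]
    exact ENat.LEInfty.out)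

/-! ### Bundle maps and Nijenhuis torsion on a Banach manifold -/

section Manifold

variable {Q : Type*} [NormedAddCommGroup Q] [NormedSpace ℝ Q]
  {M : Type*} [TopologicalSpace M] [ChartedSpace Q M]

/-- A smooth vector field on the Banach manifold `M`. -/
def IsSmoothVectorField [IsManifold 𝓘(ℝ, Q) ∞ M] (X : ∀ p : M, TangentSpace 𝓘(ℝ, Q) p) : Prop :=
  ContMDiff 𝓘(ℝ, Q) 𝓘(ℝ, Q).tangent ∞ (fun p => (⟨p, X p⟩ : TangentBundle 𝓘(ℝ, Q) M))

/-- A smooth vector bundle map `TM → TM` over the identity: a smooth section of the bundle with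
fibre `B(T_p M)` at `p`. -/
def IsSmoothBundleMap [IsManifold 𝓘(ℝ, Q) ∞ M]
    (N : ∀ p : M, TangentSpace 𝓘(ℝ, Q) p →L[ℝ] TangentSpace 𝓘(ℝ, Q) p) : Prop :=
  ContMDiff 𝓘(ℝ, Q) (𝓘(ℝ, Q).prod 𝓘(ℝ, Q →L[ℝ] Q)) ∞
    (fun p => Bundle.TotalSpace.mk' (Q →L[ℝ] Q)
      (E := fun p : M => TangentSpace 𝓘(ℝ, Q) p →L[ℝ] TangentSpace 𝓘(ℝ, Q) p) p (N p))

/-- The Nijenhuis torsion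
`Ω_N(X, Y) = N[NX, Y] + N[X, NY] - [NX, NY] - N²[X, Y]` at the point `p`. -/
def nijenhuisTorsion (N : ∀ p : M, TangentSpace 𝓘(ℝ, Q) p →L[ℝ] TangentSpace 𝓘(ℝ, Q) p)
    (X Y : ∀ p : M, TangentSpace 𝓘(ℝ, Q) p) (p : M) : TangentSpace 𝓘(ℝ, Q) p :=
  N p (VectorField.mlieBracket 𝓘(ℝ, Q) (fun q => N q (X q)) Y p)
    + N p (VectorField.mlieBracket 𝓘(ℝ, Q) X (fun q => N q (Y q)) p)
    - VectorField.mlieBracket 𝓘(ℝ, Q) (fun q => N q (X q)) (fun q => N q (Y q)) p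
    - N p (N p (VectorField.mlieBracket 𝓘(ℝ, Q) X Y p))

/-- `N` is a Nijenhuis operator: its torsion vanishes on all smooth vector fields. -/
def IsNijenhuis [IsManifold 𝓘(ℝ, Q) ∞ M]
    (N : ∀ p : M, TangentSpace 𝓘(ℝ, Q) p →L[ℝ] TangentSpace 𝓘(ℝ, Q) p) : Prop :=
  ∀ X Y : (∀ p : M, TangentSpace 𝓘(ℝ, Q) p), IsSmoothVectorField X → IsSmoothVectorField Y →
    ∀ p : M, nijenhuisTorsion N X Y p = 0

end Manifold

/-! ### The adjoint action and Banach-Lie subgroups -/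

section Subgroup

variable {E : Type*} [NormedAddCommGroup E] [NormedSpace ℝ E]
  {G : Type*} [TopologicalSpace G] [ChartedSpace E G] [Group G]

/-- `Ad_g`, the differential at `1` of `h ↦ g h g⁻¹`. The target `T_{g 1 g⁻¹} G` is `T_1 G`, since
`g 1 g⁻¹ = 1`. -/
def adjointAction (g : G) : GroupLieAlgebra 𝓘(ℝ, E) G →L[ℝ] GroupLieAlgebra 𝓘(ℝ, E) G :=
  mfderiv 𝓘(ℝ, E) 𝓘(ℝ, E) (fun h : G => g * h * g⁻¹) 1

/-- `K`, with the subspace topology and a given structure of Banach manifold modelled on `F`, is an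
(embedded) Banach-Lie subgroup of `G`: `K` is itself a Banach-Lie group, and the inclusion is a
smooth immersion, that is, its differentials are injective with closed range (the range is not
required to be complemented). -/
structure IsBanachLieSubgroup {F : Type*} [NormedAddCommGroup F] [NormedSpace ℝ F]
    (K : Subgroup G) [ChartedSpace F K] : Prop where
  lieGroup : LieGroup 𝓘(ℝ, F) ∞ K
  smooth_incl : ContMDiff 𝓘(ℝ, F) 𝓘(ℝ, E) ∞ (fun k : K => (k : G))
  injective_mfderiv : ∀ k : K,
    Function.Injective (mfderiv 𝓘(ℝ, F) 𝓘(ℝ, E) (fun k : K => (k : G)) k)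
  isClosed_range_mfderiv : ∀ k : K,
    IsClosed (Set.range (mfderiv 𝓘(ℝ, F) 𝓘(ℝ, E) (fun k : K => (k : G)) k))

/-- The Lie algebra `𝔨 ⊆ 𝔤` of the Banach-Lie subgroup `K`: the image of `T_1 K` in `T_1 G`. -/
def subgroupLieAlgebra (E : Type*) [NormedAddCommGroup E] [NormedSpace ℝ E]
    (F : Type*) [NormedAddCommGroup F] [NormedSpace ℝ F]
    {G : Type*} [TopologicalSpace G] [ChartedSpace E G] [Group G]
    (K : Subgroup G) [ChartedSpace F K] : Submodule ℝ (GroupLieAlgebra 𝓘(ℝ, E) G) :=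
  LinearMap.range
    (mfderiv 𝓘(ℝ, F) 𝓘(ℝ, E) (fun k : K => (k : G)) (1 : K)).toLinearMap

/-- Admissible bounded operators `J` on `𝔤`: `J 𝔨 ⊆ 𝔨`, and `Ran(Ad_k J - J Ad_k) ⊆ 𝔨` for every
`k ∈ K`. -/
structure IsAdmissible {F : Type*} [NormedAddCommGroup F] [NormedSpace ℝ F]
    (K : Subgroup G) [ChartedSpace F K]
    (J : GroupLieAlgebra 𝓘(ℝ, E) G →L[ℝ] GroupLieAlgebra 𝓘(ℝ, E) G) : Prop where
  map_mem : ∀ v ∈ subgroupLieAlgebra E F K, J v ∈ subgroupLieAlgebra E F K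
  adjoint_comm : ∀ k ∈ K, ∀ v : GroupLieAlgebra 𝓘(ℝ, E) G,
    adjointAction k (J v) - J (adjointAction k v) ∈ subgroupLieAlgebra E F K

/-- Admissible operators `J` on `𝔤` with `Ran(J² + 1) ⊆ 𝔨`. -/
structure IsAdmissibleComplex {F : Type*} [NormedAddCommGroup F] [NormedSpace ℝ F]
    (K : Subgroup G) [ChartedSpace F K]
    (J : GroupLieAlgebra 𝓘(ℝ, E) G →L[ℝ] GroupLieAlgebra 𝓘(ℝ, E) G) : Prop
    extends IsAdmissible (F := F) K J where
  sq_add_one_mem : ∀ v : GroupLieAlgebra 𝓘(ℝ, E) G, J (J v) + v ∈ subgroupLieAlgebra E F K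

/-- `Z₊ = {v ∈ 𝔤^ℂ : (J^ℂ - i) v ∈ 𝔨^ℂ}`, a complex subspace of `𝔤^ℂ = ℂ ⊗ 𝔤`. -/
def zPlus {F : Type*} [NormedAddCommGroup F] [NormedSpace ℝ F]
    (K : Subgroup G) [ChartedSpace F K]
    (J : GroupLieAlgebra 𝓘(ℝ, E) G →L[ℝ] GroupLieAlgebra 𝓘(ℝ, E) G) :
    Submodule ℂ (ℂ ⊗[ℝ] GroupLieAlgebra 𝓘(ℝ, E) G) :=
  ((subgroupLieAlgebra E F K).baseChange ℂ).comap
    (J.toLinearMap.baseChange ℂ - Complex.I • LinearMap.id)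

end Subgroup

/-! ### Homogeneous spaces and homogeneous structures -/

section Homogeneous

variable {E : Type*} [NormedAddCommGroup E] [NormedSpace ℝ E]
  {Q : Type*} [NormedAddCommGroup Q] [NormedSpace ℝ Q]
  {G : Type*} [TopologicalSpace G] [ChartedSpace E G] [Group G]
  {K : Subgroup G} [ChartedSpace Q (G ⧸ K)]

/-- The given manifold structure on `G ⧸ K` (with the quotient topology) makes it a homogeneous
space of `G`: it is a smooth Hausdorff manifold, and the quotient map `π : G → G ⧸ K` is a
submersion, that is, it is smooth and its differentials are surjective (the kernels are not
required to be complemented). -/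
structure IsHomogeneousSpace (E : Type*) [NormedAddCommGroup E] [NormedSpace ℝ E]
    (Q : Type*) [NormedAddCommGroup Q] [NormedSpace ℝ Q]
    {G : Type*} [TopologicalSpace G] [ChartedSpace E G] [Group G]
    (K : Subgroup G) [ChartedSpace Q (G ⧸ K)] : Prop where
  t2Space : T2Space (G ⧸ K)
  smooth_mk : ContMDiff 𝓘(ℝ, E) 𝓘(ℝ, Q) ∞ (fun g : G => (g : G ⧸ K))
  surjective_mfderiv : ∀ g : G,
    Function.Surjective (mfderiv 𝓘(ℝ, E) 𝓘(ℝ, Q) (fun g : G => (g : G ⧸ K)) g)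

/-- A bundle map of `T(G/K)` is homogeneous if it is smooth and
`(α_g)_* N_p = N_{α_g(p)} (α_g)_*` for all `g` and `p`, where `α_g(p) = g • p`. -/
structure IsHomogeneousBundleMap [IsManifold 𝓘(ℝ, Q) ∞ (G ⧸ K)]
    (N : ∀ p : G ⧸ K, TangentSpace 𝓘(ℝ, Q) p →L[ℝ] TangentSpace 𝓘(ℝ, Q) p) : Prop where
  smooth : IsSmoothBundleMap N
  invariant : ∀ (g : G) (p : G ⧸ K) (x : TangentSpace 𝓘(ℝ, Q) p),
    mfderiv 𝓘(ℝ, Q) 𝓘(ℝ, Q) (fun q : G ⧸ K => g • q) p (N p x) =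
      N (g • p) (mfderiv 𝓘(ℝ, Q) 𝓘(ℝ, Q) (fun q : G ⧸ K => g • q) p x)

/-- A homogeneous almost complex structure on `G ⧸ K`: a homogeneous bundle map with square `-1`. -/
structure IsHomogeneousAlmostComplex [IsManifold 𝓘(ℝ, Q) ∞ (G ⧸ K)]
    (N : ∀ p : G ⧸ K, TangentSpace 𝓘(ℝ, Q) p →L[ℝ] TangentSpace 𝓘(ℝ, Q) p) : Prop
    extends IsHomogeneousBundleMap N where
  sq_eq_neg_one : ∀ (p : G ⧸ K) (x : TangentSpace 𝓘(ℝ, Q) p), N p (N p x) = -x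

/-- The bundle map `N` of `T(G/K)` is the one induced by the operator `J` on `𝔤`: at the base
point `p₀ = π(1)` it satisfies `N_{p₀} π_{*1} v = π_{*1} J v`, and
`N_{α_g(p₀)} = (α_g)_* N_{p₀} (α_g)_*⁻¹` for all `g ∈ G`. -/
structure IsInducedBy
    (N : ∀ p : G ⧸ K, TangentSpace 𝓘(ℝ, Q) p →L[ℝ] TangentSpace 𝓘(ℝ, Q) p)
    (J : GroupLieAlgebra 𝓘(ℝ, E) G →L[ℝ] GroupLieAlgebra 𝓘(ℝ, E) G) : Prop where
  at_base : ∀ v : GroupLieAlgebra 𝓘(ℝ, E) G,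
    N ((1 : G) : G ⧸ K) (mfderiv 𝓘(ℝ, E) 𝓘(ℝ, Q) (fun g : G => (g : G ⧸ K)) (1 : G) v) =
      mfderiv 𝓘(ℝ, E) 𝓘(ℝ, Q) (fun g : G => (g : G ⧸ K)) (1 : G) (J v)
  transport : ∀ (g : G) (x : TangentSpace 𝓘(ℝ, Q) ((1 : G) : G ⧸ K)),
    N (g • ((1 : G) : G ⧸ K))
        (mfderiv 𝓘(ℝ, Q) 𝓘(ℝ, Q) (fun q : G ⧸ K => g • q) ((1 : G) : G ⧸ K) x) =
      mfderiv 𝓘(ℝ, Q) 𝓘(ℝ, Q) (fun q : G ⧸ K => g • q) ((1 : G) : G ⧸ K)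
        (N ((1 : G) : G ⧸ K) x)

end Homogeneous

end

/-! The torsion is tensorial: its value at a point depends only on the values of X and Y there. For
v in 𝔤 the left-invariant fields of v and Jv satisfy π_*(Jv) = 𝒥 π_* v at every point of G. They
need not descend to G/K, but this relation is enough to compute the torsion upstairs.
Differentiating it in charts and using the symmetry of the second derivative of π gives
(`localTorsion_fderiv`, `IsInducedBy.nijenhuisTorsion_eq`) that Ω at gK, on the projections of v and
w, is the translated projection of J[Jv,w] + J[v,Jw] - [Jv,Jw] - J²[v,w].

Since ker π_{*1} = 𝔨, vanishing of Ω means that this algebraic torsion takes values in 𝔨. Writing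
elements of Z₊ as a + ib with Ja + b and Jb - a in 𝔨 turns that into closure of Z₊ under brackets
(`lie_mem_comap_baseChange_iff`). The algebra needs [u,Jw] - J[u,w] ∈ 𝔨 for u in 𝔨, and [𝔨,𝔨] ⊂ 𝔨;
both come from bracketing with a vertical field (`mfderiv_mlieBracket_of_vertical`).

The analytic difficulty is that ker π_* need not be complemented, so π may have no smooth local
sections. Metric regularity, a consequence of the open mapping theorem, replaces them. It shows that
a map on G/K is as regular as its pullback to G (`HasStrictFDerivAt.differentiableAt_of_comp`,
`ContDiffAt.of_comp_submersion`), which yields differentiability of α_g and smoothness of the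
fundamental vector fields. The latter realise every tangent vector at p₀. It also produces, for v in
ker π_{*1}, a curve in K tangent to v, whence v ∈ 𝔨 (`IsHomogeneousSpace.mem_subgroupLieAlgebra`).
-/

noncomputable section

/-! ### Regularity descends along submersions with uncomplemented kernels -/

section Descent

open Filter Topology Asymptotics

variable {E : Type*} [NormedAddCommGroup E] [NormedSpace ℝ E]
  {Q : Type*} [NormedAddCommGroup Q] [NormedSpace ℝ Q]
  {W : Type*} [NormedAddCommGroup W] [NormedSpace ℝ W]
  {X : Type*} [NormedAddCommGroup X] [NormedSpace ℝ X]

/-- Metric regularity at a point where the strict derivative is surjective. -/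
theorem HasStrictFDerivAt.exists_preimage_norm_sub_le [CompleteSpace E] [CompleteSpace Q]
    {f : E → Q} {f' : E →L[ℝ] Q} {a : E}
    (hf : HasStrictFDerivAt f f' a) (hsurj : Function.Surjective f') :
    ∃ C : ℝ, 0 < C ∧ ∀ᶠ p : E × Q in 𝓝 (a, f a), ∃ x, f x = p.2 ∧ ‖x - p.1‖ ≤ C * ‖p.2 - f p.1‖ := by
  obtain ⟨r, hr⟩ := f'.exists_nonlinearRightInverse_of_surjective (LinearMap.range_eq_top.2 hsurj)
  have hr' : (0 : ℝ) < r.nnnorm := hr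
  -- Any constant below ‖r‖⁻¹ would do: the image of a ball of radius ε then contains a ball of
  -- radius (‖r‖⁻¹ - c)ε, and half leaves a positive margin k.
  obtain ⟨s, hs, happ⟩ := hf.approximates_deriv_on_nhds (c := r.nnnorm⁻¹ / 2)
    (Or.inr (by positivity))
  obtain ⟨ρ, hρ, hball⟩ := Metric.mem_nhds_iff.1 hs
  set k : ℝ := (r.nnnorm : ℝ)⁻¹ - ((r.nnnorm⁻¹ / 2 : NNReal) : ℝ) with hk
  have hk0 : 0 < k := by
    rw [hk]; push_cast
    have : (0 : ℝ) < (r.nnnorm : ℝ)⁻¹ := inv_pos.2 hr'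
    linarith
  refine ⟨k⁻¹, inv_pos.2 hk0, ?_⟩
  have h1 : ∀ᶠ p : E × Q in 𝓝 (a, f a), ‖p.1 - a‖ < ρ / 2 := by
    have : ContinuousAt (fun p : E × Q => ‖p.1 - a‖) (a, f a) := by fun_prop
    exact this.eventually_lt continuousAt_const (by simpa using half_pos hρ)
  have h2 : ∀ᶠ p : E × Q in 𝓝 (a, f a), k⁻¹ * ‖p.2 - f p.1‖ < ρ / 2 := by
    have hfc : ContinuousAt (fun p : E × Q => f p.1) (a, f a) :=
      ContinuousAt.comp (f := Prod.fst) (g := f) hf.continuousAt continuousAt_fst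
    have : ContinuousAt (fun p : E × Q => k⁻¹ * ‖p.2 - f p.1‖) (a, f a) :=
      continuousAt_const.mul (continuousAt_snd.sub hfc).norm
    exact this.eventually_lt continuousAt_const (by simpa using half_pos hρ)
  filter_upwards [h1, h2] with p hp1 hp2
  have hsub : Metric.closedBall p.1 (k⁻¹ * ‖p.2 - f p.1‖) ⊆ s := by
    intro x hx
    apply hball
    rw [Metric.mem_ball, dist_eq_norm]
    rw [Metric.mem_closedBall, dist_eq_norm] at hx
    calc ‖x - a‖ = ‖(x - p.1) + (p.1 - a)‖ := by congr 1; abel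
      _ ≤ ‖x - p.1‖ + ‖p.1 - a‖ := norm_add_le _ _
      _ < ρ := by linarith
  obtain ⟨x, hx, hxy⟩ := happ.surjOn_closedBall_of_nonlinearRightInverse r (by positivity) hsub
    (show p.2 ∈ _ by
      rw [Metric.mem_closedBall, dist_eq_norm, ← hk, mul_inv_cancel_left₀ hk0.ne'])
  exact ⟨x, hxy, by simpa [dist_eq_norm] using hx⟩

/-- A bounded operator vanishing on the kernel of a bounded surjection factors through it. -/
theorem ContinuousLinearMap.exists_comp_eq_of_ker_le [CompleteSpace E] [CompleteSpace Q]
    (P : E →L[ℝ] Q) (hP : Function.Surjective P) (T : E →L[ℝ] W) (h : ∀ v, P v = 0 → T v = 0) :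
    ∃ A : Q →L[ℝ] W, A.comp P = T := by
  obtain ⟨C, hC0, hC⟩ := P.exists_preimage_norm_le hP
  obtain ⟨g, hg⟩ := P.toLinearMap.exists_rightInverse_of_surjective (LinearMap.range_eq_top.2 hP)
  have hg' : ∀ y, P (g y) = y := fun y => LinearMap.congr_fun hg y
  have hT : ∀ x, T (g (P x)) = T x := fun x => by
    have := h (g (P x) - x) (by simp [hg'])
    simpa [sub_eq_zero] using this
  refine ⟨(T.toLinearMap ∘ₗ g).mkContinuous (‖T‖ * C) fun y => ?_, ?_⟩
  · obtain ⟨x, rfl, hx⟩ := hC y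
    calc ‖T (g (P x))‖ = ‖T x‖ := by rw [hT]
      _ ≤ ‖T‖ * ‖x‖ := T.le_opNorm x
      _ ≤ ‖T‖ * (C * ‖P x‖) := by gcongr
      _ = ‖T‖ * C * ‖P x‖ := by ring
  · ext x
    exact hT x

/-- By the open mapping theorem each y has a preimage of norm at most C‖y‖, so precomposition with P
is bounded below. This allows estimates on B to be read off from B ∘ P. -/
theorem ContinuousLinearMap.exists_norm_le_norm_comp [CompleteSpace E] [CompleteSpace Q]
    (P : E →L[ℝ] Q) (hP : Function.Surjective P) :
    ∃ C : ℝ, 0 < C ∧ ∀ A : Q →L[ℝ] W, ‖A‖ ≤ C * ‖A.comp P‖ := by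
  obtain ⟨C, hC0, hC⟩ := P.exists_preimage_norm_le hP
  refine ⟨C, hC0, fun A => A.opNorm_le_bound (by positivity) fun y => ?_⟩
  obtain ⟨x, rfl, hx⟩ := hC y
  calc ‖A (P x)‖ = ‖A.comp P x‖ := rfl
    _ ≤ ‖A.comp P‖ * ‖x‖ := (A.comp P).le_opNorm x
    _ ≤ ‖A.comp P‖ * (C * ‖P x‖) := by gcongr
    _ = C * ‖A.comp P‖ * ‖P x‖ := by ring

/-- If `h ∘ f` is differentiable at `a` and `f` is a submersion at `a` (no complement of the kernel
being required), then `h` is differentiable at `f a`. -/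
theorem HasStrictFDerivAt.differentiableAt_of_comp [CompleteSpace E] [CompleteSpace Q]
    {f : E → Q} {f' : E →L[ℝ] Q} {a : E} (hf : HasStrictFDerivAt f f' a)
    (hsurj : Function.Surjective f') {h : Q → W} (hF : DifferentiableAt ℝ (fun x => h (f x)) a) :
    DifferentiableAt ℝ h (f a) := by
  obtain ⟨F', hF'⟩ := hF
  obtain ⟨C, hC0, hC⟩ := hf.exists_preimage_norm_sub_le hsurj
  have hC' : ∀ᶠ y in 𝓝 (f a), ∃ x, f x = y ∧ ‖x - a‖ ≤ C * ‖y - f a‖ := by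
    have : Tendsto (fun y : Q => (a, y)) (𝓝 (f a)) (𝓝 (a, f a)) :=
      (Continuous.prodMk_right a).tendsto (f a)
    exact this.eventually hC
  -- A set-theoretic section of f near f a, Lipschitz only at the base point; this suffices for
  -- first-order estimates at f a.
  obtain ⟨σ, hσ⟩ : ∃ σ : Q → E, ∀ᶠ y in 𝓝 (f a), f (σ y) = y ∧ ‖σ y - a‖ ≤ C * ‖y - f a‖ := by
    classical
    refine ⟨fun y => if hy : ∃ x, f x = y ∧ ‖x - a‖ ≤ C * ‖y - f a‖ then hy.choose else a, ?_⟩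
    filter_upwards [hC'] with y hy
    rw [dif_pos hy]
    exact hy.choose_spec
  have hO : (fun y => σ y - a) =O[𝓝 (f a)] fun y => y - f a :=
    IsBigO.of_bound C (hσ.mono fun y hy => hy.2)
  have hσt : Tendsto σ (𝓝 (f a)) (𝓝 a) := by
    rw [tendsto_iff_norm_sub_tendsto_zero]
    have : Tendsto (fun y => C * ‖y - f a‖) (𝓝 (f a)) (𝓝 0) := by
      have hc : Continuous fun y => C * ‖y - f a‖ := by fun_prop
      simpa using hc.tendsto (f a)
    exact squeeze_zero' (.of_forall fun _ => norm_nonneg _) (hσ.mono fun y hy => hy.2) this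
  -- Along a + tv the value of f moves by o(t). Replacing a + tv by σ(f(a + tv)), which is
  -- o(t)-close to a, does not change h ∘ f, so h ∘ f has zero derivative along this line.
  have hker : ∀ v, f' v = 0 → F' v = 0 := by
    intro v hv
    have hline : HasDerivAt (fun t : ℝ => a + t • v) v 0 := by
      simpa using ((hasDerivAt_id (0 : ℝ)).smul_const v).const_add a
    have hl0 : a = (fun t : ℝ => a + t • v) 0 := by simp
    have hft : HasDerivAt (fun t : ℝ => f (a + t • v)) 0 0 := by
      have := (hl0 ▸ hf.hasFDerivAt : HasFDerivAt f f' ((fun t : ℝ => a + t • v) 0)).comp_hasDerivAt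
        (0 : ℝ) hline
      simpa [hv, Function.comp_def] using this
    have hFt : HasDerivAt (fun t : ℝ => h (f (a + t • v))) (F' v) 0 := by
      have := (hl0 ▸ hF' : HasFDerivAt (fun x => h (f x)) F'
        ((fun t : ℝ => a + t • v) 0)).comp_hasDerivAt (0 : ℝ) hline
      simpa [Function.comp_def] using this
    have hfto : (fun t : ℝ => f (a + t • v) - f a) =o[𝓝 0] fun t : ℝ => t := by
      simpa [hasDerivAt_iff_isLittleO] using hft
    have htend : Tendsto (fun t : ℝ => f (a + t • v)) (𝓝 0) (𝓝 (f a)) := by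
      simpa using hft.continuousAt.tendsto
    have h0 : HasDerivAt (fun t : ℝ => h (f (a + t • v))) 0 0 := by
      rw [hasDerivAt_iff_isLittleO]
      have e1 : (fun t : ℝ => h (f (σ (f (a + t • v)))) - h (f a)) =O[𝓝 0]
          fun t => σ (f (a + t • v)) - a :=
        hF'.isBigO_sub.comp_tendsto (hσt.comp htend)
      have e2 : (fun t : ℝ => σ (f (a + t • v)) - a) =O[𝓝 0] fun t => f (a + t • v) - f a :=
        hO.comp_tendsto htend
      refine ((e1.trans e2).trans_isLittleO hfto).congr' ?_ (by simp)
      filter_upwards [htend.eventually hσ] with t ht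
      simp [ht.1]
    exact hFt.unique h0
  obtain ⟨A, hA⟩ := f'.exists_comp_eq_of_ker_le hsurj F' hker
  refine ⟨A, ?_⟩
  rw [hasFDerivAt_iff_isLittleO]
  have o1 : (fun y => h (f (σ y)) - h (f a) - F' (σ y - a)) =o[𝓝 (f a)] fun y => y - f a :=
    (hF'.isLittleO.comp_tendsto hσt).trans_isBigO hO
  have o2 : (fun y => A (f (σ y) - f a - f' (σ y - a))) =o[𝓝 (f a)] fun y => y - f a :=
    (A.isBigO_comp _ _).trans_isLittleO
      ((hf.hasFDerivAt.isLittleO.comp_tendsto hσt).trans_isBigO hO)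
  refine (o1.sub o2).congr' ?_ .rfl
  filter_upwards [hσ] with y hy
  have : F' (σ y - a) = A (f' (σ y - a)) := by rw [← hA]; rfl
  rw [hy.1, this, map_sub A (y - f a)]
  abel

-- An absorption argument: expanding (B x - B x₀) ∘ P x₀ leaves an error ‖B x - B x₀‖‖P x - P x₀‖,
-- which moves to the left-hand side once C‖P x - P x₀‖ ≤ 1/2.
omit [NormedSpace ℝ X] in
theorem ContinuousLinearMap.continuousAt_of_comp [CompleteSpace E] [CompleteSpace Q]
    {P : X → E →L[ℝ] Q} {B : X → Q →L[ℝ] W} {x₀ : X} (hsurj : Function.Surjective (P x₀))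
    (hP : ContinuousAt P x₀) (hC : ContinuousAt (fun x => (B x).comp (P x)) x₀) :
    ContinuousAt B x₀ := by
  obtain ⟨C, hC0, hCb⟩ := (P x₀).exists_norm_le_norm_comp (W := W) hsurj
  have hsplit : ∀ x, (B x - B x₀).comp (P x₀) =
      ((B x).comp (P x) - (B x₀).comp (P x₀)) - (B x - B x₀).comp (P x - P x₀)
        - (B x₀).comp (P x - P x₀) := by
    intro x; ext v; simp; abel
  have hsmall : ∀ᶠ x in 𝓝 x₀, C * ‖P x - P x₀‖ ≤ 1 / 2 := by
    have : ContinuousAt (fun x => C * ‖P x - P x₀‖) x₀ :=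
      continuousAt_const.mul (hP.sub continuousAt_const).norm
    exact (this.eventually_lt continuousAt_const (by simp)).mono fun x hx => hx.le
  have hlim : Tendsto (fun x => 2 * (C * (‖(B x).comp (P x) - (B x₀).comp (P x₀)‖
      + ‖B x₀‖ * ‖P x - P x₀‖))) (𝓝 x₀) (𝓝 0) := by
    have : ContinuousAt (fun x => 2 * (C * (‖(B x).comp (P x) - (B x₀).comp (P x₀)‖
      + ‖B x₀‖ * ‖P x - P x₀‖))) x₀ :=
      continuousAt_const.mul (continuousAt_const.mul
        ((hC.sub continuousAt_const).norm.add
          (continuousAt_const.mul (hP.sub continuousAt_const).norm)))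
    simpa [ContinuousAt] using this
  rw [ContinuousAt, tendsto_iff_norm_sub_tendsto_zero]
  refine squeeze_zero' (.of_forall fun _ => norm_nonneg _) ?_ hlim
  filter_upwards [hsmall] with x hx
  have h1 := hCb (B x - B x₀)
  rw [hsplit x] at h1
  have h2 : ‖((B x).comp (P x) - (B x₀).comp (P x₀)) - (B x - B x₀).comp (P x - P x₀)
        - (B x₀).comp (P x - P x₀)‖ ≤ ‖(B x).comp (P x) - (B x₀).comp (P x₀)‖
        + ‖B x - B x₀‖ * ‖P x - P x₀‖ + ‖B x₀‖ * ‖P x - P x₀‖ := by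
    refine (norm_sub_le _ _).trans (add_le_add ((norm_sub_le _ _).trans (add_le_add le_rfl ?_)) ?_)
    · exact ContinuousLinearMap.opNorm_comp_le _ _
    · exact ContinuousLinearMap.opNorm_comp_le _ _
  have h3 := mul_le_mul_of_nonneg_left h2 hC0.le
  have h4 := mul_le_mul_of_nonneg_right hx (norm_nonneg (B x - B x₀))
  nlinarith

/-- Freezing P at x₀ costs (B x - B x₀) ∘ (P x - P x₀), which is o(1) · O(x - x₀) by continuity of
B. The derivative of x ↦ B x ∘ P x₀ kills ker P x₀ in its second argument, so it factors through P
x₀, and the factor is the derivative of B. -/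
theorem ContinuousLinearMap.differentiableAt_of_comp [CompleteSpace E] [CompleteSpace Q]
    {P : X → E →L[ℝ] Q} {B : X → Q →L[ℝ] W} {x₀ : X} (hsurj : Function.Surjective (P x₀))
    (hP : DifferentiableAt ℝ P x₀) (hC : DifferentiableAt ℝ (fun x => (B x).comp (P x)) x₀) :
    DifferentiableAt ℝ B x₀ := by
  have hB := ContinuousLinearMap.continuousAt_of_comp hsurj hP.continuousAt hC.continuousAt
  obtain ⟨C, hC0, hCb⟩ := (P x₀).exists_norm_le_norm_comp (W := W) hsurj
  have hrem : HasFDerivAt (fun x => (B x - B x₀).comp (P x - P x₀)) (0 : X →L[ℝ] E →L[ℝ] W) x₀ := by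
    rw [hasFDerivAt_iff_isLittleO]
    have o1 : (fun x => B x - B x₀) =o[𝓝 x₀] fun _ => (1 : ℝ) := by
      rw [isLittleO_one_iff]
      exact tendsto_sub_nhds_zero_iff.2 hB
    have o2 : (fun x => P x - P x₀) =O[𝓝 x₀] fun x => x - x₀ := hP.hasFDerivAt.isBigO_sub
    have o3 := o1.norm_left.mul_isBigO o2.norm_norm
    refine (IsBigO.of_bound 1 (.of_forall fun x => ?_)).trans_isLittleO
      (o3.congr_right (g₂ := fun x => ‖x - x₀‖) (fun x => by simp)) |>.of_norm_right
    simpa using ContinuousLinearMap.opNorm_comp_le (B x - B x₀) (P x - P x₀)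
  have hb : DifferentiableAt ℝ (fun x => (B x).comp (P x₀)) x₀ := by
    have h1 : DifferentiableAt ℝ (fun x => (B x).comp (P x) - (B x - B x₀).comp (P x - P x₀)
        - (B x₀).comp (P x - P x₀)) x₀ :=
      (hC.sub hrem.differentiableAt).sub
        ((differentiableAt_const (B x₀)).clm_comp (hP.sub_const (P x₀)))
    convert h1 using 2 with x
    ext v; simp; abel
  obtain ⟨D, hD⟩ := hb
  have hker : ∀ v, P x₀ v = 0 → D.flip v = 0 := by
    intro v hv
    have h1 := hD.clm_apply (hasFDerivAt_const v x₀)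
    have h2 : HasFDerivAt (fun x => (B x).comp (P x₀) v) (0 : X →L[ℝ] W) x₀ := by
      simpa [hv] using hasFDerivAt_const (0 : W) x₀
    have := h1.unique h2
    simpa using this
  obtain ⟨A, hA⟩ := (P x₀).exists_comp_eq_of_ker_le hsurj D.flip hker
  refine ⟨A.flip, ?_⟩
  rw [hasFDerivAt_iff_isLittleO] at hD ⊢
  refine IsBigO.trans_isLittleO (IsBigO.of_bound C (.of_forall fun x => ?_)) hD
  refine (hCb _).trans_eq ?_
  congr 2
  ext v
  have : A (P x₀ v) = D.flip v := by rw [← hA]; rfl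
  simp [this]


theorem ContinuousLinearMap.contDiff_flip {n : WithTop ℕ∞} :
    ContDiff ℝ n (fun T : X →L[ℝ] E →L[ℝ] W => T.flip) :=
  IsBoundedLinearMap.contDiff ⟨⟨fun _ _ => rfl, fun _ _ => rfl⟩, 1, one_pos, fun T => by simp⟩

universe u v

/-- If `x ↦ B x ∘ P x` and `P` are `C^n` and the operators `P x` are onto, then `B` is `C^n`. -/
theorem ContDiffOn.of_clm_comp_surjective {E : Type u} [NormedAddCommGroup E] [NormedSpace ℝ E]
    [CompleteSpace E] {Q : Type v} [NormedAddCommGroup Q] [NormedSpace ℝ Q] [CompleteSpace Q]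
    {s : Set E} (hs : IsOpen s) {P : E → E →L[ℝ] Q} (hsurj : ∀ x ∈ s, Function.Surjective (P x))
    (n : ℕ) (hP : ContDiffOn ℝ n P s) :
    -- The target stays quantified because the induction step passes from W to E →L W; the universe
    -- `max u v` is closed under this.
    ∀ {W : Type (max u v)} [NormedAddCommGroup W] [NormedSpace ℝ W] {B : E → Q →L[ℝ] W},
      ContDiffOn ℝ n (fun x => (B x).comp (P x)) s → ContDiffOn ℝ n B s := by
  induction n with
  | zero =>
    intro W _ _ B hC
    simp only [Nat.cast_zero, contDiffOn_zero] at hP hC ⊢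
    intro x hx
    exact (ContinuousLinearMap.continuousAt_of_comp (hsurj x hx)
      (hP.continuousAt (hs.mem_nhds hx)) (hC.continuousAt (hs.mem_nhds hx))).continuousWithinAt
  | succ n ih =>
    intro W _ _ B hC
    have hle : (n : WithTop ℕ∞) ≤ ((n + 1 : ℕ) : WithTop ℕ∞) := by exact_mod_cast n.le_succ
    have hPn := hP.of_le hle
    have hBn : ContDiffOn ℝ n B s := ih hPn (hC.of_le hle)
    have hPd : ∀ x ∈ s, DifferentiableAt ℝ P x := fun x hx =>
      (hP.contDiffAt (hs.mem_nhds hx)).differentiableAt (by simp)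
    have hCd : ∀ x ∈ s, DifferentiableAt ℝ (fun x => (B x).comp (P x)) x := fun x hx =>
      (hC.contDiffAt (hs.mem_nhds hx)).differentiableAt (by simp)
    have hBd : ∀ x ∈ s, DifferentiableAt ℝ B x := fun x hx =>
      ContinuousLinearMap.differentiableAt_of_comp (hsurj x hx) (hPd x hx) (hCd x hx)
    push_cast at hP hC ⊢
    rw [contDiffOn_succ_iff_fderiv_of_isOpen hs] at hP hC ⊢
    refine ⟨fun x hx => (hBd x hx).differentiableWithinAt, by simp, ?_⟩
    -- By the product rule, DB composed with P is D(B ∘ P) minus B composed with DP, and both terms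
    -- are already known to be of class C^n. The flip moves P to the slot where the induction
    -- hypothesis applies.
    have hkey : ContDiffOn ℝ n (fun x => ((fderiv ℝ B x).flip).comp (P x)) s := by
      have h1 : ContDiffOn ℝ n (fun x => (fderiv ℝ (fun x => (B x).comp (P x)) x -
          ((ContinuousLinearMap.compL ℝ E Q W) (B x)).comp (fderiv ℝ P x)).flip) s := by
        refine ContinuousLinearMap.contDiff_flip.comp_contDiffOn
          (hC.2.2.sub (ContDiffOn.clm_comp ?_ hP.2.2))
        exact (ContinuousLinearMap.contDiff (F := (E →L[ℝ] Q) →L[ℝ] E →L[ℝ] W)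
          (ContinuousLinearMap.compL ℝ E Q W)).comp_contDiffOn hBn
      refine h1.congr fun x hx => ?_
      rw [((hBd x hx).hasFDerivAt.clm_comp (hPd x hx).hasFDerivAt).fderiv]
      ext u w
      simp
    exact ContinuousLinearMap.contDiff_flip.comp_contDiffOn (ih hPn hkey)

/-- If `h ∘ f` is `C^n` and `f` is a submersion (no complements of kernels being required), then
`h` is `C^n` on the image of `f`. -/
theorem ContDiffOn.of_comp_submersion {E : Type u} [NormedAddCommGroup E] [NormedSpace ℝ E]
    [CompleteSpace E] {Q : Type v} [NormedAddCommGroup Q] [NormedSpace ℝ Q] [CompleteSpace Q]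
    {s : Set E} (hs : IsOpen s) {f : E → Q}
    (hsurj : ∀ x ∈ s, Function.Surjective (fderiv ℝ f x)) (n : ℕ)
    (hf : ContDiffOn ℝ (n + 1) f s) :
    ∀ {W : Type (max u v)} [NormedAddCommGroup W] [NormedSpace ℝ W] {h : Q → W},
      ContDiffOn ℝ n (fun x => h (f x)) s → ContDiffOn ℝ n h (f '' s) := by
  have hstrict : ∀ {m : ℕ}, ContDiffOn ℝ (m + 1) f s → ∀ x ∈ s,
      HasStrictFDerivAt f (fderiv ℝ f x) x := fun hf x hx =>
    (hf.contDiffAt (hs.mem_nhds hx)).hasStrictFDerivAt (by simp)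
  have hmap : ∀ x ∈ s, map f (𝓝 x) = 𝓝 (f x) := fun x hx =>
    (hstrict hf x hx).map_nhds_eq_of_surj (LinearMap.range_eq_top.2 (hsurj x hx))
  have hopen : IsOpen (f '' s) := by
    rw [isOpen_iff_mem_nhds]
    rintro _ ⟨x, hx, rfl⟩
    rw [← hmap x hx]
    exact image_mem_map (hs.mem_nhds hx)
  clear hmap
  induction n with
  | zero =>
    intro W _ _ h hF
    simp only [Nat.cast_zero, contDiffOn_zero] at hF ⊢
    rintro _ ⟨x, hx, rfl⟩
    apply ContinuousAt.continuousWithinAt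
    rw [ContinuousAt, ← (hstrict hf x hx).map_nhds_eq_of_surj
      (LinearMap.range_eq_top.2 (hsurj x hx)), tendsto_map'_iff]
    exact hF.continuousAt (hs.mem_nhds hx)
  | succ n ih =>
    intro W _ _ h hF
    have hfn : ContDiffOn ℝ (n + 1) f s := hf.of_le (by norm_cast; omega)
    have hFd : ∀ x ∈ s, DifferentiableAt ℝ (fun x => h (f x)) x := fun x hx =>
      (hF.contDiffAt (hs.mem_nhds hx)).differentiableAt (by simp)
    have hhd : ∀ x ∈ s, DifferentiableAt ℝ h (f x) := fun x hx =>
      (hstrict hf x hx).differentiableAt_of_comp (hsurj x hx) (hFd x hx)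
    push_cast at hF ⊢
    rw [contDiffOn_succ_iff_fderiv_of_isOpen hs] at hF
    rw [contDiffOn_succ_iff_fderiv_of_isOpen hopen]
    refine ⟨?_, by simp, ?_⟩
    · rintro _ ⟨x, hx, rfl⟩
      exact (hhd x hx).differentiableWithinAt
    · refine ih hfn ?_
      -- The chain rule gives D(h ∘ f) = (Dh ∘ f) Df, so the operator version recovers Dh ∘ f, and
      -- the induction hypothesis then descends Dh itself.
      have hf' := ((contDiffOn_succ_iff_fderiv_of_isOpen hs).1 hfn).2.2
      refine ContDiffOn.of_clm_comp_surjective hs hsurj n hf' (hF.2.2.congr fun x hx => ?_)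
      exact (fderiv_comp x (hhd x hx) (hstrict hf x hx).differentiableAt).symm

/-- Pointwise version of `ContDiffOn.of_comp_submersion`, with an arbitrary target. -/
theorem ContDiffAt.of_comp_submersion {E : Type u} [NormedAddCommGroup E] [NormedSpace ℝ E]
    [CompleteSpace E] {Q : Type v} [NormedAddCommGroup Q] [NormedSpace ℝ Q] [CompleteSpace Q]
    {W : Type v} [NormedAddCommGroup W] [NormedSpace ℝ W]
    {f : E → Q} {a : E} (hf : ContDiffAt ℝ ∞ f a)
    (hsurj : ∀ᶠ x in 𝓝 a, Function.Surjective (fderiv ℝ f x)) {h : Q → W} (n : ℕ)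
    (hF : ContDiffAt ℝ n (fun x => h (f x)) a) : ContDiffAt ℝ n h (f a) := by
  have hfn : ContDiffAt ℝ ((n + 1 : ℕ) : WithTop ℕ∞) f a :=
    hf.of_le (by exact_mod_cast le_top)
  have e1 := hfn.eventually (by simp)
  have e2 := hF.eventually (by simp)
  obtain ⟨s, hsub, hs, has⟩ := eventually_nhds_iff.1 (e1.and (e2.and hsurj))
  -- Lifting the target to the universe in which the induction was run.
  let up : W ≃L[ℝ] ULift.{max u v} W := ContinuousLinearEquiv.ulift.symm
  have hU : ContDiffOn ℝ n (fun x => up (h (f x))) s := fun x hx =>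
    (up.contDiff.contDiffAt.comp x (hsub x hx).2.1).contDiffWithinAt
  have hfs : ContDiffOn ℝ (n + 1) f s := fun x hx => by
    exact_mod_cast (hsub x hx).1.contDiffWithinAt
  have hres := ContDiffOn.of_comp_submersion (h := fun y => up (h y)) hs
    (fun x hx => (hsub x hx).2.2) n hfs hU
  have hnhds : f '' s ∈ 𝓝 (f a) := by
    rw [← ((hfs.contDiffAt (hs.mem_nhds has)).hasStrictFDerivAt (by simp)).map_nhds_eq_of_surj
      (LinearMap.range_eq_top.2 (hsub a has).2.2)]
    exact image_mem_map (hs.mem_nhds has)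
  exact up.symm.contDiff.contDiffAt.comp (f a) (hres.contDiffAt hnhds)

end Descent

/-! ### Torsion and brackets in a normed space -/

section LocalTorsion

open VectorField Filter Topology

variable {E : Type*} [NormedAddCommGroup E] [NormedSpace ℝ E]
  {Q : Type*} [NormedAddCommGroup Q] [NormedSpace ℝ Q]

/-- The Nijenhuis torsion of an operator field on a normed space, on constant vector fields. -/
def localTorsion (N : Q → Q →L[ℝ] Q) (y a b : Q) : Q :=
  N y (fderiv ℝ N y a b - fderiv ℝ N y b a) - fderiv ℝ N y (N y a) b + fderiv ℝ N y (N y b) a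

/-- The Nijenhuis torsion is tensorial. -/
theorem localTorsion_eq_lieBracket {N : Q → Q →L[ℝ] Q} {X Y : Q → Q} {y : Q}
    (hN : DifferentiableAt ℝ N y) (hX : DifferentiableAt ℝ X y) (hY : DifferentiableAt ℝ Y y) :
    N y (lieBracket ℝ (fun z => N z (X z)) Y y) + N y (lieBracket ℝ X (fun z => N z (Y z)) y)
      - lieBracket ℝ (fun z => N z (X z)) (fun z => N z (Y z)) y - N y (N y (lieBracket ℝ X Y y)) =
    localTorsion N y (X y) (Y y) := by
  simp only [lieBracket, localTorsion, fderiv_clm_apply hN hX, fderiv_clm_apply hN hY]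
  simp
  abel

/-- The two second-derivative terms of f cancel by symmetry. This expresses the projected bracket
through derivatives of projected fields, although these fields are functions upstairs and need not
descend. -/
theorem fderiv_apply_lieBracket {f : E → Q} {V W : E → E} {x : E} (hf : ContDiffAt ℝ 2 f x)
    (hV : DifferentiableAt ℝ V x) (hW : DifferentiableAt ℝ W x) :
    fderiv ℝ f x (lieBracket ℝ V W x) =
      fderiv ℝ (fun z => fderiv ℝ f z (W z)) x (V x) -
        fderiv ℝ (fun z => fderiv ℝ f z (V z)) x (W x) := by
  have hf' : DifferentiableAt ℝ (fderiv ℝ f) x :=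
    (hf.fderiv_right (m := 1) (by norm_num)).differentiableAt (by simp)
  have hsymm : fderiv ℝ (fderiv ℝ f) x (V x) (W x) = fderiv ℝ (fderiv ℝ f) x (W x) (V x) :=
    hf.isSymmSndFDerivAt (by simp) (V x) (W x)
  simp only [lieBracket, fderiv_clm_apply hf' hV, fderiv_clm_apply hf' hW]
  simp [hsymm]

/-- Differentiates the relation between V' and V. The DN terms produced here are the ones that
assemble into `localTorsion`. -/
theorem fderiv_operator_field {f : E → Q} {N : Q → Q →L[ℝ] Q} {V V' : E → E} {x : E}
    (hf : ContDiffAt ℝ 2 f x) (hN : DifferentiableAt ℝ N (f x)) (hV : DifferentiableAt ℝ V x)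
    (h : ∀ᶠ z in 𝓝 x, fderiv ℝ f z (V' z) = N (f z) (fderiv ℝ f z (V z))) (u : E) :
    fderiv ℝ (fun z => fderiv ℝ f z (V' z)) x u =
      fderiv ℝ N (f x) (fderiv ℝ f x u) (fderiv ℝ f x (V x)) +
        N (f x) (fderiv ℝ (fun z => fderiv ℝ f z (V z)) x u) := by
  have hf' : DifferentiableAt ℝ (fderiv ℝ f) x :=
    (hf.fderiv_right (m := 1) (by norm_num)).differentiableAt (by simp)
  have hfd : DifferentiableAt ℝ f x := hf.differentiableAt (by simp)
  have hNf : DifferentiableAt ℝ (fun z => N (f z)) x := hN.comp x hfd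
  rw [EventuallyEq.fderiv_eq h, fderiv_clm_apply hNf (hf'.clm_apply hV),
    fderiv_fun_comp x hN hfd]
  simp [add_comm]

/-- The torsion on projections of vector fields `V`, `W` upstairs, when `V'`, `W'` project to the
images of their projections under the operator field. -/
theorem localTorsion_fderiv {f : E → Q} {N : Q → Q →L[ℝ] Q} {V V' W W' : E → E} {x : E}
    (hf : ContDiffAt ℝ 2 f x) (hN : DifferentiableAt ℝ N (f x))
    (hV : DifferentiableAt ℝ V x) (hV' : DifferentiableAt ℝ V' x)
    (hW : DifferentiableAt ℝ W x) (hW' : DifferentiableAt ℝ W' x)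
    (hVV' : ∀ᶠ z in 𝓝 x, fderiv ℝ f z (V' z) = N (f z) (fderiv ℝ f z (V z)))
    (hWW' : ∀ᶠ z in 𝓝 x, fderiv ℝ f z (W' z) = N (f z) (fderiv ℝ f z (W z))) :
    localTorsion N (f x) (fderiv ℝ f x (V x)) (fderiv ℝ f x (W x)) =
      N (f x) (fderiv ℝ f x (lieBracket ℝ V' W x)) + N (f x) (fderiv ℝ f x (lieBracket ℝ V W' x))
        - fderiv ℝ f x (lieBracket ℝ V' W' x)
        - N (f x) (N (f x) (fderiv ℝ f x (lieBracket ℝ V W x))) := by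
  have eV := fderiv_operator_field hf hN hV hVV'
  have eW := fderiv_operator_field hf hN hW hWW'
  simp only [fderiv_apply_lieBracket hf hV hW, fderiv_apply_lieBracket hf hV' hW,
    fderiv_apply_lieBracket hf hV hW', fderiv_apply_lieBracket hf hV' hW', eV, eW,
    hVV'.self_of_nhds, hWW'.self_of_nhds, localTorsion]
  simp
  abel

/-- Bracket with a vertical vector field. -/
theorem fderiv_lieBracket_of_vertical {f : E → Q} {N : Q → Q →L[ℝ] Q} {V W W' : E → E} {x : E}
    (hf : ContDiffAt ℝ 2 f x) (hN : DifferentiableAt ℝ N (f x))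
    (hV : DifferentiableAt ℝ V x) (hW : DifferentiableAt ℝ W x) (hW' : DifferentiableAt ℝ W' x)
    (hV0 : ∀ᶠ z in 𝓝 x, fderiv ℝ f z (V z) = 0)
    (hWW' : ∀ᶠ z in 𝓝 x, fderiv ℝ f z (W' z) = N (f z) (fderiv ℝ f z (W z))) :
    fderiv ℝ f x (lieBracket ℝ V W' x) = N (f x) (fderiv ℝ f x (lieBracket ℝ V W x)) := by
  have eW := fderiv_operator_field hf hN hW hWW'
  have e0 : fderiv ℝ (fun z => fderiv ℝ f z (V z)) x = 0 := by
    rw [EventuallyEq.fderiv_eq hV0]; simp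
  simp [fderiv_apply_lieBracket hf hV hW, fderiv_apply_lieBracket hf hV hW', eW, e0,
    hV0.self_of_nhds]

end LocalTorsion

/-! ### Transfer between manifolds and preferred charts -/

section Charts

open VectorField Filter Topology Set

variable {Q : Type*} [NormedAddCommGroup Q] [NormedSpace ℝ Q]
  {M : Type*} [TopologicalSpace M] [ChartedSpace Q M] [IsManifold 𝓘(ℝ, Q) ∞ M]

/-- The expression of a vector field in the preferred chart at `p`. -/
def chartField (p : M) (X : ∀ q : M, TangentSpace 𝓘(ℝ, Q) q) : Q → Q :=
  mpullbackWithin 𝓘(ℝ, Q) 𝓘(ℝ, Q) (extChartAt 𝓘(ℝ, Q) p).symm X (range 𝓘(ℝ, Q))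

/-- The differential of the chart at `p`, at the point with coordinate `y`. -/
def chartDeriv (p : M) (y : Q) :
    TangentSpace 𝓘(ℝ, Q) ((extChartAt 𝓘(ℝ, Q) p).symm y) →L[ℝ] Q :=
  mfderiv 𝓘(ℝ, Q) 𝓘(ℝ, Q) (extChartAt 𝓘(ℝ, Q) p) ((extChartAt 𝓘(ℝ, Q) p).symm y)

/-- The differential of the inverse of the chart at `p`. -/
def chartSymmDeriv (p : M) (y : Q) :
    Q →L[ℝ] TangentSpace 𝓘(ℝ, Q) ((extChartAt 𝓘(ℝ, Q) p).symm y) :=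
  mfderivWithin 𝓘(ℝ, Q) 𝓘(ℝ, Q) (extChartAt 𝓘(ℝ, Q) p).symm (range 𝓘(ℝ, Q)) y

/-- The expression of a field of operators in the preferred chart at `p`. -/
def chartOperator (p : M) (N : ∀ q : M, TangentSpace 𝓘(ℝ, Q) q →L[ℝ] TangentSpace 𝓘(ℝ, Q) q) :
    Q → Q →L[ℝ] Q := fun y =>
  (chartDeriv p y).comp ((N ((extChartAt 𝓘(ℝ, Q) p).symm y)).comp (chartSymmDeriv p y))

theorem chartDeriv_chartSymmDeriv {p : M} {y : Q} (hy : y ∈ (extChartAt 𝓘(ℝ, Q) p).target) (v : Q) :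
    chartDeriv p y (chartSymmDeriv p y v) = v :=
  DFunLike.congr_fun (mfderiv_extChartAt_comp_mfderivWithin_extChartAt_symm hy) v

theorem chartSymmDeriv_chartDeriv {p : M} {y : Q} (hy : y ∈ (extChartAt 𝓘(ℝ, Q) p).target)
    (v : TangentSpace 𝓘(ℝ, Q) ((extChartAt 𝓘(ℝ, Q) p).symm y)) :
    chartSymmDeriv p y (chartDeriv p y v) = v :=
  DFunLike.congr_fun (mfderivWithin_extChartAt_symm_comp_mfderiv_extChartAt hy) v

theorem chartField_apply {p : M} (X : ∀ q : M, TangentSpace 𝓘(ℝ, Q) q) {y : Q}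
    (hy : y ∈ (extChartAt 𝓘(ℝ, Q) p).target) :
    chartField p X y = chartDeriv p y (X ((extChartAt 𝓘(ℝ, Q) p).symm y)) := by
  have h : (mfderivWithin 𝓘(ℝ, Q) 𝓘(ℝ, Q) (extChartAt 𝓘(ℝ, Q) p).symm (range 𝓘(ℝ, Q)) y).inverse =
      mfderiv 𝓘(ℝ, Q) 𝓘(ℝ, Q) (extChartAt 𝓘(ℝ, Q) p) ((extChartAt 𝓘(ℝ, Q) p).symm y) :=
    ContinuousLinearMap.inverse_eq
      (mfderivWithin_extChartAt_symm_comp_mfderiv_extChartAt hy)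
      (mfderiv_extChartAt_comp_mfderivWithin_extChartAt_symm hy)
  rw [chartField, mpullbackWithin_apply, h]
  rfl

/-- The tangent space at p is the model space read in the preferred chart at p, so the chart
differential is the identity there. The auxiliary statement over q = p handles base points that
agree only propositionally. -/
theorem chartDeriv_self (p : M) (v : TangentSpace 𝓘(ℝ, Q) p) :
    chartDeriv p (extChartAt 𝓘(ℝ, Q) p p)
      (v : TangentSpace 𝓘(ℝ, Q) ((extChartAt 𝓘(ℝ, Q) p).symm (extChartAt 𝓘(ℝ, Q) p p))) = v := by
  have h : ∀ q : M, q = p → ∀ w : Q, (mfderiv 𝓘(ℝ, Q) 𝓘(ℝ, Q) (extChartAt 𝓘(ℝ, Q) p) q :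
      Q →L[ℝ] Q) w = w := by
    rintro q rfl w
    exact DFunLike.congr_fun (mfderiv_extChartAt_self (I := 𝓘(ℝ, Q)) (x := q)) w
  exact h _ (extChartAt_to_inv p) v

theorem chartSymmDeriv_self (p : M) (v : TangentSpace 𝓘(ℝ, Q) p) :
    (chartSymmDeriv p (extChartAt 𝓘(ℝ, Q) p p) v : Q) = v := by
  have h := chartDeriv_chartSymmDeriv (mem_extChartAt_target (I := 𝓘(ℝ, Q)) p) v
  have h' := chartDeriv_self p (chartSymmDeriv p (extChartAt 𝓘(ℝ, Q) p p) v)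
  exact h'.symm.trans h

theorem chartField_self (p : M) (X : ∀ q : M, TangentSpace 𝓘(ℝ, Q) q) :
    chartField p X (extChartAt 𝓘(ℝ, Q) p p) = X p := by
  have h : ∀ q : M, q = p → (X q : Q) = X p := by rintro q rfl; rfl
  rw [chartField_apply X (mem_extChartAt_target p)]
  exact (chartDeriv_self p _).trans (h _ (extChartAt_to_inv p))

theorem chartOperator_self (p : M)
    (N : ∀ q : M, TangentSpace 𝓘(ℝ, Q) q →L[ℝ] TangentSpace 𝓘(ℝ, Q) q) (v : Q) :
    chartOperator p N (extChartAt 𝓘(ℝ, Q) p p) v = N p v := by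
  have h : ∀ q : M, q = p → ∀ w : Q, (N q w : Q) = N p w := by rintro q rfl w; rfl
  have h1 := chartSymmDeriv_self p v
  refine (chartDeriv_self p _).trans ((h _ (extChartAt_to_inv p) _).trans ?_)
  exact congrArg (N p) h1

theorem chartField_operator_eventuallyEq (p : M)
    (N : ∀ q : M, TangentSpace 𝓘(ℝ, Q) q →L[ℝ] TangentSpace 𝓘(ℝ, Q) q)
    (X : ∀ q : M, TangentSpace 𝓘(ℝ, Q) q) :
    chartField p (fun q => N q (X q)) =ᶠ[𝓝 (extChartAt 𝓘(ℝ, Q) p p)]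
      fun y => chartOperator p N y (chartField p X y) := by
  filter_upwards [extChartAt_target_mem_nhds (I := 𝓘(ℝ, Q)) p] with y hy
  rw [chartField_apply _ hy, chartField_apply _ hy]
  show _ = chartDeriv p y (N _ (chartSymmDeriv p y (chartDeriv p y _)))
  rw [chartSymmDeriv_chartDeriv hy]

theorem differentiableAt_chartField [CompleteSpace Q] {p : M} {X : ∀ q : M, TangentSpace 𝓘(ℝ, Q) q}
    (hX : MDifferentiableAt 𝓘(ℝ, Q) 𝓘(ℝ, Q).tangent
      (fun z => (⟨z, X z⟩ : TangentBundle 𝓘(ℝ, Q) M)) p) :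
    DifferentiableAt ℝ (chartField p X) (extChartAt 𝓘(ℝ, Q) p p) := by
  have h : MDifferentiableWithinAt 𝓘(ℝ, Q) 𝓘(ℝ, Q).tangent
      (fun q => (⟨q, X q⟩ : TangentBundle 𝓘(ℝ, Q) M)) univ p :=
    hX.mdifferentiableWithinAt
  have := h.differentiableWithinAt_mpullbackWithin_vectorField
  rw [← differentiableWithinAt_univ]
  simpa [chartField] using this

/-- The manifold bracket is the pullback by the chart of the bracket of the local expressions, and
the chart differential at the centre is the identity. -/
theorem mlieBracket_eq_chartField (X Y : ∀ q : M, TangentSpace 𝓘(ℝ, Q) q) (p : M) :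
    mlieBracket 𝓘(ℝ, Q) X Y p =
      lieBracket ℝ (chartField p X) (chartField p Y) (extChartAt 𝓘(ℝ, Q) p p) := by
  have h : ∀ (T : Q →L[ℝ] Q) (v : Q), T = ContinuousLinearMap.id ℝ Q → T.inverse v = v := by
    rintro _ v rfl
    simp
  refine (h _ _ (mfderiv_extChartAt_self (I := 𝓘(ℝ, Q)) (x := p))).trans ?_
  have haux : ∀ (s : Set Q) (A B : Q → Q) (a : Q), s = univ →
      lieBracketWithin ℝ A B s a = lieBracket ℝ A B a := by
    rintro _ A B a rfl
    rw [lieBracketWithin_univ]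
  exact haux _ (chartField p X) (chartField p Y) _ (by simp)

/-- In the trivialization of the endomorphism bundle at p, the coordinates of N are N conjugated by
the chart differential. Differentiability at the centre is enough, as the torsion involves only
first derivatives there. -/
theorem differentiableAt_chartOperator {p : M}
    {N : ∀ q : M, TangentSpace 𝓘(ℝ, Q) q →L[ℝ] TangentSpace 𝓘(ℝ, Q) q} (hN : IsSmoothBundleMap N) :
    DifferentiableAt ℝ (chartOperator p N) (extChartAt 𝓘(ℝ, Q) p p) := by
  have h := ((contMDiffAt_hom_bundle _).1 (hN p)).2
  have h1 : MDifferentiableAt 𝓘(ℝ, Q) 𝓘(ℝ, Q →L[ℝ] Q) (fun q => ContinuousLinearMap.inCoordinates Q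
      (TangentSpace 𝓘(ℝ, Q)) Q (TangentSpace 𝓘(ℝ, Q)) p q p q (N q)) p :=
    h.mdifferentiableAt (by simp)
  have h2 : MDifferentiableAt 𝓘(ℝ, Q) 𝓘(ℝ, Q) (extChartAt 𝓘(ℝ, Q) p).symm
      (extChartAt 𝓘(ℝ, Q) p p) := by
    have := mdifferentiableWithinAt_extChartAt_symm (I := 𝓘(ℝ, Q)) (mem_extChartAt_target p)
    rw [← mdifferentiableWithinAt_univ]
    simpa using this
  have h3 := (MDifferentiableAt.comp_of_eq (extChartAt 𝓘(ℝ, Q) p p) h1 h2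
    (extChartAt_to_inv p)).differentiableAt
  refine h3.congr_of_eventuallyEq ?_
  filter_upwards [extChartAt_target_mem_nhds (I := 𝓘(ℝ, Q)) p] with y hy
  have hy' : (extChartAt 𝓘(ℝ, Q) p).symm y ∈ (chartAt Q p).source := by
    simpa using (extChartAt 𝓘(ℝ, Q) p).map_target hy
  simp only [Function.comp_apply, ContinuousLinearMap.inCoordinates]
  rw [TangentBundle.continuousLinearMapAt_trivializationAt hy', TangentBundle.symmL_trivializationAt hy',
    (extChartAt 𝓘(ℝ, Q) p).right_inv hy]
  rfl

/-- The Nijenhuis torsion at a point, computed in a chart. -/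
theorem nijenhuisTorsion_eq_localTorsion [CompleteSpace Q]
    {N : ∀ q : M, TangentSpace 𝓘(ℝ, Q) q →L[ℝ] TangentSpace 𝓘(ℝ, Q) q} (hN : IsSmoothBundleMap N)
    {X Y : ∀ q : M, TangentSpace 𝓘(ℝ, Q) q} (hX : IsSmoothVectorField X)
    (hY : IsSmoothVectorField Y) (p : M) :
    nijenhuisTorsion N X Y p =
      localTorsion (chartOperator p N) (extChartAt 𝓘(ℝ, Q) p p) (X p) (Y p) := by
  have h := localTorsion_eq_lieBracket (differentiableAt_chartOperator (p := p) hN)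
    (differentiableAt_chartField ((hX p).mdifferentiableAt (by simp)))
    (differentiableAt_chartField ((hY p).mdifferentiableAt (by simp)))
  have hop : chartOperator p N (extChartAt 𝓘(ℝ, Q) p p) = (N p : Q →L[ℝ] Q) :=
    ContinuousLinearMap.ext (chartOperator_self p N)
  have hNX := chartField_operator_eventuallyEq p N X
  have hNY := chartField_operator_eventuallyEq p N Y
  rw [chartField_self, chartField_self, ← hNX.lieBracket_vectorField_eq EventuallyEq.rfl,
    ← (EventuallyEq.refl _ (chartField p X)).lieBracket_vectorField_eq hNY,
    ← hNX.lieBracket_vectorField_eq hNY, ← mlieBracket_eq_chartField, ← mlieBracket_eq_chartField,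
    ← mlieBracket_eq_chartField, ← mlieBracket_eq_chartField, hop] at h
  exact h

variable {E : Type*} [NormedAddCommGroup E] [NormedSpace ℝ E]
  {H : Type*} [TopologicalSpace H] [ChartedSpace E H] [IsManifold 𝓘(ℝ, E) ∞ H]

/-- The expression of a map between manifolds in the preferred charts at `x` and `f x`. -/
def chartMap (Q : Type*) [NormedAddCommGroup Q] [NormedSpace ℝ Q] {M : Type*} [TopologicalSpace M]
    [ChartedSpace Q M] (E : Type*) [NormedAddCommGroup E] [NormedSpace ℝ E]
    {H : Type*} [TopologicalSpace H] [ChartedSpace E H] (f : H → M) (x : H) : E → Q := fun y =>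
  extChartAt 𝓘(ℝ, Q) (f x) (f ((extChartAt 𝓘(ℝ, E) x).symm y))

variable {f : H → M} {x : H}

omit [IsManifold 𝓘(ℝ, Q) ∞ M] [IsManifold 𝓘(ℝ, E) ∞ H] in
theorem chartMap_self :
    chartMap Q E f x (extChartAt 𝓘(ℝ, E) x x) = extChartAt 𝓘(ℝ, Q) (f x) (f x) := by
  rw [chartMap, extChartAt_to_inv]

omit [IsManifold 𝓘(ℝ, Q) ∞ M] [IsManifold 𝓘(ℝ, E) ∞ H] in
theorem contDiffAt_chartMap {n : WithTop ℕ∞} (hf : ContMDiffAt 𝓘(ℝ, E) 𝓘(ℝ, Q) n f x) :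
    ContDiffAt ℝ n (chartMap Q E f x) (extChartAt 𝓘(ℝ, E) x x) := by
  have := (contMDiffAt_iff.1 hf).2
  rw [← contDiffWithinAt_univ]
  unfold chartMap
  simpa [Function.comp_def] using this

omit [IsManifold 𝓘(ℝ, Q) ∞ M] [IsManifold 𝓘(ℝ, E) ∞ H] in
theorem eventually_mem_charts (hf : ContinuousAt f x) :
    ∀ᶠ y in 𝓝 (extChartAt 𝓘(ℝ, E) x x), y ∈ (extChartAt 𝓘(ℝ, E) x).target ∧
      f ((extChartAt 𝓘(ℝ, E) x).symm y) ∈ (extChartAt 𝓘(ℝ, Q) (f x)).source := by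
  refine Filter.Eventually.and (extChartAt_target_mem_nhds (I := 𝓘(ℝ, E)) x) ?_
  have h1 : ContinuousAt (extChartAt 𝓘(ℝ, E) x).symm (extChartAt 𝓘(ℝ, E) x x) :=
    continuousAt_extChartAt_symm x
  have h2 : ContinuousAt (fun y => f ((extChartAt 𝓘(ℝ, E) x).symm y))
      (extChartAt 𝓘(ℝ, E) x x) :=
    ContinuousAt.comp_of_eq hf h1 (extChartAt_to_inv x)
  refine h2.eventually_mem ?_
  rw [extChartAt_to_inv]
  exact extChartAt_source_mem_nhds (f x)

theorem fderiv_chartMap (hf : MDifferentiable 𝓘(ℝ, E) 𝓘(ℝ, Q) f) {y : E}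
    (hy : y ∈ (extChartAt 𝓘(ℝ, E) x).target)
    (hy' : f ((extChartAt 𝓘(ℝ, E) x).symm y) ∈ (extChartAt 𝓘(ℝ, Q) (f x)).source) (v : E) :
    fderiv ℝ (chartMap Q E f x) y v =
      (mfderiv 𝓘(ℝ, Q) 𝓘(ℝ, Q) (extChartAt 𝓘(ℝ, Q) (f x)) (f ((extChartAt 𝓘(ℝ, E) x).symm y)) :
        Q →L[ℝ] Q) ((mfderiv 𝓘(ℝ, E) 𝓘(ℝ, Q) f ((extChartAt 𝓘(ℝ, E) x).symm y) : E →L[ℝ] Q)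
          (chartSymmDeriv x y v)) := by
  have haux : ∀ (s : Set E) (D : E →L[ℝ] E), s = univ →
      HasMFDerivWithinAt 𝓘(ℝ, E) 𝓘(ℝ, E) (extChartAt 𝓘(ℝ, E) x).symm s y D →
      HasMFDerivAt 𝓘(ℝ, E) 𝓘(ℝ, E) (extChartAt 𝓘(ℝ, E) x).symm y D := by
    rintro _ D rfl h
    exact hasMFDerivWithinAt_univ.1 h
  have h1 : HasMFDerivAt 𝓘(ℝ, E) 𝓘(ℝ, E) (extChartAt 𝓘(ℝ, E) x).symm y (chartSymmDeriv x y) :=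
    haux _ _ (by simp) (mdifferentiableWithinAt_extChartAt_symm (I := 𝓘(ℝ, E)) hy).hasMFDerivWithinAt
  have h2 := (hf ((extChartAt 𝓘(ℝ, E) x).symm y)).hasMFDerivAt
  have h3 : HasMFDerivAt 𝓘(ℝ, Q) 𝓘(ℝ, Q) (extChartAt 𝓘(ℝ, Q) (f x))
      (f ((extChartAt 𝓘(ℝ, E) x).symm y)) _ :=
    (mdifferentiableAt_extChartAt (by simpa using hy')).hasMFDerivAt
  have h4 : HasFDerivAt (chartMap Q E f x)
      ((mfderiv 𝓘(ℝ, Q) 𝓘(ℝ, Q) (extChartAt 𝓘(ℝ, Q) (f x)) (f ((extChartAt 𝓘(ℝ, E) x).symm y)) :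
        Q →L[ℝ] Q).comp ((mfderiv 𝓘(ℝ, E) 𝓘(ℝ, Q) f ((extChartAt 𝓘(ℝ, E) x).symm y) :
          E →L[ℝ] Q).comp (chartSymmDeriv x y : E →L[ℝ] E))) y :=
    (HasMFDerivAt.comp y h3 (HasMFDerivAt.comp y h2 h1)).hasFDerivAt
  have hcomp : ∀ (g : E → Q) (A : Q →L[ℝ] Q) (B : E →L[ℝ] Q) (C : E →L[ℝ] E),
      HasFDerivAt g (A.comp (B.comp C)) y → fderiv ℝ g y v = A (B (C v)) := by
    intro g A B C h
    rw [h.fderiv]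
    rfl
  exact hcomp _ _ _ _ h4

theorem fderiv_chartMap_chartField (hf : MDifferentiable 𝓘(ℝ, E) 𝓘(ℝ, Q) f) {y : E}
    (hy : y ∈ (extChartAt 𝓘(ℝ, E) x).target)
    (hy' : f ((extChartAt 𝓘(ℝ, E) x).symm y) ∈ (extChartAt 𝓘(ℝ, Q) (f x)).source)
    (V : ∀ z : H, TangentSpace 𝓘(ℝ, E) z) :
    fderiv ℝ (chartMap Q E f x) y (chartField x V y) =
      (mfderiv 𝓘(ℝ, Q) 𝓘(ℝ, Q) (extChartAt 𝓘(ℝ, Q) (f x)) (f ((extChartAt 𝓘(ℝ, E) x).symm y)) :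
        Q →L[ℝ] Q) ((mfderiv 𝓘(ℝ, E) 𝓘(ℝ, Q) f ((extChartAt 𝓘(ℝ, E) x).symm y) : E →L[ℝ] Q)
          (V ((extChartAt 𝓘(ℝ, E) x).symm y))) := by
  rw [fderiv_chartMap hf hy hy', chartField_apply V hy, chartSymmDeriv_chartDeriv hy]

omit [IsManifold 𝓘(ℝ, Q) ∞ M] [IsManifold 𝓘(ℝ, E) ∞ H] in
theorem fderiv_chartMap_self (hf : MDifferentiableAt 𝓘(ℝ, E) 𝓘(ℝ, Q) f x) :
    fderiv ℝ (chartMap Q E f x) (extChartAt 𝓘(ℝ, E) x x) =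
      (mfderiv 𝓘(ℝ, E) 𝓘(ℝ, Q) f x : E →L[ℝ] Q) := by
  have haux : ∀ (s : Set E) (g : E → Q) (a : E), s = univ →
      fderivWithin ℝ g s a = fderiv ℝ g a := by
    rintro _ g a rfl
    exact congrFun fderivWithin_univ a
  exact (hf.mfderiv.trans (haux _ _ _ (by simp))).symm

/-- Conjugating N by the target chart carries the relation on the manifold to a relation near the
centre, ready for the local lemmas. -/
theorem fderiv_chartMap_related (hf : MDifferentiable 𝓘(ℝ, E) 𝓘(ℝ, Q) f)
    {N : ∀ q : M, TangentSpace 𝓘(ℝ, Q) q →L[ℝ] TangentSpace 𝓘(ℝ, Q) q}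
    {V V' : ∀ z : H, TangentSpace 𝓘(ℝ, E) z}
    (h : ∀ z, mfderiv 𝓘(ℝ, E) 𝓘(ℝ, Q) f z (V' z) =
      N (f z) (mfderiv 𝓘(ℝ, E) 𝓘(ℝ, Q) f z (V z))) :
    ∀ᶠ y in 𝓝 (extChartAt 𝓘(ℝ, E) x x), fderiv ℝ (chartMap Q E f x) y (chartField x V' y) =
      chartOperator (f x) N (chartMap Q E f x y)
        (fderiv ℝ (chartMap Q E f x) y (chartField x V y)) := by
  filter_upwards [eventually_mem_charts (Q := Q) (hf x).continuousAt] with y ⟨hy, hy'⟩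
  rw [fderiv_chartMap_chartField hf hy hy', fderiv_chartMap_chartField hf hy hy']
  set z := (extChartAt 𝓘(ℝ, E) x).symm y
  have hq : chartMap Q E f x y = extChartAt 𝓘(ℝ, Q) (f x) (f z) := rfl
  have key : ∀ q ∈ (extChartAt 𝓘(ℝ, Q) (f x)).source, ∀ w : TangentSpace 𝓘(ℝ, Q) q,
      (mfderiv 𝓘(ℝ, Q) 𝓘(ℝ, Q) (extChartAt 𝓘(ℝ, Q) (f x)) q : Q →L[ℝ] Q) (N q w) =
      chartOperator (f x) N (extChartAt 𝓘(ℝ, Q) (f x) q)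
        ((mfderiv 𝓘(ℝ, Q) 𝓘(ℝ, Q) (extChartAt 𝓘(ℝ, Q) (f x)) q : Q →L[ℝ] Q) w) := by
    intro q hq
    obtain ⟨u, hu, rfl⟩ : ∃ u ∈ (extChartAt 𝓘(ℝ, Q) (f x)).target,
        (extChartAt 𝓘(ℝ, Q) (f x)).symm u = q :=
      ⟨_, (extChartAt 𝓘(ℝ, Q) (f x)).map_source hq, (extChartAt 𝓘(ℝ, Q) (f x)).left_inv hq⟩
    intro w
    rw [(extChartAt 𝓘(ℝ, Q) (f x)).right_inv hu]
    show chartDeriv _ u (N _ w) =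
      chartDeriv _ u (N _ (chartSymmDeriv _ u (chartDeriv _ u w)))
    rw [chartSymmDeriv_chartDeriv hu]
  rw [hq, ← key _ hy', ← h z]

/-- The Nijenhuis torsion on vectors that are projections of values of vector fields upstairs. -/
theorem nijenhuisTorsion_of_related [CompleteSpace E] [CompleteSpace Q]
    (hf : ContMDiff 𝓘(ℝ, E) 𝓘(ℝ, Q) ∞ f)
    {N : ∀ q : M, TangentSpace 𝓘(ℝ, Q) q →L[ℝ] TangentSpace 𝓘(ℝ, Q) q} (hN : IsSmoothBundleMap N)
    {V V' W W' : ∀ z : H, TangentSpace 𝓘(ℝ, E) z}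
    (hV : MDifferentiableAt 𝓘(ℝ, E) 𝓘(ℝ, E).tangent
      (fun z => (⟨z, V z⟩ : TangentBundle 𝓘(ℝ, E) H)) x)
    (hV' : MDifferentiableAt 𝓘(ℝ, E) 𝓘(ℝ, E).tangent
      (fun z => (⟨z, V' z⟩ : TangentBundle 𝓘(ℝ, E) H)) x)
    (hW : MDifferentiableAt 𝓘(ℝ, E) 𝓘(ℝ, E).tangent
      (fun z => (⟨z, W z⟩ : TangentBundle 𝓘(ℝ, E) H)) x)
    (hW' : MDifferentiableAt 𝓘(ℝ, E) 𝓘(ℝ, E).tangent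
      (fun z => (⟨z, W' z⟩ : TangentBundle 𝓘(ℝ, E) H)) x)
    (hVV' : ∀ z, mfderiv 𝓘(ℝ, E) 𝓘(ℝ, Q) f z (V' z) =
      N (f z) (mfderiv 𝓘(ℝ, E) 𝓘(ℝ, Q) f z (V z)))
    (hWW' : ∀ z, mfderiv 𝓘(ℝ, E) 𝓘(ℝ, Q) f z (W' z) =
      N (f z) (mfderiv 𝓘(ℝ, E) 𝓘(ℝ, Q) f z (W z)))
    {X Y : ∀ q : M, TangentSpace 𝓘(ℝ, Q) q} (hX : IsSmoothVectorField X)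
    (hY : IsSmoothVectorField Y) (hXV : X (f x) = mfderiv 𝓘(ℝ, E) 𝓘(ℝ, Q) f x (V x))
    (hYW : Y (f x) = mfderiv 𝓘(ℝ, E) 𝓘(ℝ, Q) f x (W x)) :
    nijenhuisTorsion N X Y (f x) =
      N (f x) (mfderiv 𝓘(ℝ, E) 𝓘(ℝ, Q) f x (mlieBracket 𝓘(ℝ, E) V' W x))
        + N (f x) (mfderiv 𝓘(ℝ, E) 𝓘(ℝ, Q) f x (mlieBracket 𝓘(ℝ, E) V W' x))
        - mfderiv 𝓘(ℝ, E) 𝓘(ℝ, Q) f x (mlieBracket 𝓘(ℝ, E) V' W' x)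
        - N (f x) (N (f x) (mfderiv 𝓘(ℝ, E) 𝓘(ℝ, Q) f x (mlieBracket 𝓘(ℝ, E) V W x))) := by
  have hfd : MDifferentiable 𝓘(ℝ, E) 𝓘(ℝ, Q) f := hf.mdifferentiable (by simp)
  have hNd : DifferentiableAt ℝ (chartOperator (f x) N)
      (chartMap Q E f x (extChartAt 𝓘(ℝ, E) x x)) := by
    rw [chartMap_self]
    exact differentiableAt_chartOperator hN
  have h := localTorsion_fderiv ((contDiffAt_chartMap (hf x)).of_le ENat.LEInfty.out) hNd
    (differentiableAt_chartField hV) (differentiableAt_chartField hV')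
    (differentiableAt_chartField hW) (differentiableAt_chartField hW')
    (fderiv_chartMap_related hfd hVV') (fderiv_chartMap_related hfd hWW')
  have hop : chartOperator (f x) N (extChartAt 𝓘(ℝ, Q) (f x) (f x)) = (N (f x) : Q →L[ℝ] Q) :=
    ContinuousLinearMap.ext (chartOperator_self (f x) N)
  rw [chartMap_self, chartField_self, chartField_self, ← mlieBracket_eq_chartField,
    ← mlieBracket_eq_chartField, ← mlieBracket_eq_chartField, ← mlieBracket_eq_chartField,
    fderiv_chartMap_self (hfd x), hop] at h
  rw [nijenhuisTorsion_eq_localTorsion hN hX hY, hXV, hYW]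
  exact h

/-- The bracket of a vertical vector field with a related pair of vector fields. -/
theorem mfderiv_mlieBracket_of_vertical [CompleteSpace E]
    (hf : ContMDiff 𝓘(ℝ, E) 𝓘(ℝ, Q) ∞ f)
    {N : ∀ q : M, TangentSpace 𝓘(ℝ, Q) q →L[ℝ] TangentSpace 𝓘(ℝ, Q) q} (hN : IsSmoothBundleMap N)
    {V W W' : ∀ z : H, TangentSpace 𝓘(ℝ, E) z}
    (hV : MDifferentiableAt 𝓘(ℝ, E) 𝓘(ℝ, E).tangent
      (fun z => (⟨z, V z⟩ : TangentBundle 𝓘(ℝ, E) H)) x)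
    (hW : MDifferentiableAt 𝓘(ℝ, E) 𝓘(ℝ, E).tangent
      (fun z => (⟨z, W z⟩ : TangentBundle 𝓘(ℝ, E) H)) x)
    (hW' : MDifferentiableAt 𝓘(ℝ, E) 𝓘(ℝ, E).tangent
      (fun z => (⟨z, W' z⟩ : TangentBundle 𝓘(ℝ, E) H)) x)
    (hV0 : ∀ z, mfderiv 𝓘(ℝ, E) 𝓘(ℝ, Q) f z (V z) = 0)
    (hWW' : ∀ z, mfderiv 𝓘(ℝ, E) 𝓘(ℝ, Q) f z (W' z) =
      N (f z) (mfderiv 𝓘(ℝ, E) 𝓘(ℝ, Q) f z (W z))) :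
    mfderiv 𝓘(ℝ, E) 𝓘(ℝ, Q) f x (mlieBracket 𝓘(ℝ, E) V W' x) =
      N (f x) (mfderiv 𝓘(ℝ, E) 𝓘(ℝ, Q) f x (mlieBracket 𝓘(ℝ, E) V W x)) := by
  have hfd : MDifferentiable 𝓘(ℝ, E) 𝓘(ℝ, Q) f := hf.mdifferentiable (by simp)
  have hNd : DifferentiableAt ℝ (chartOperator (f x) N)
      (chartMap Q E f x (extChartAt 𝓘(ℝ, E) x x)) := by
    rw [chartMap_self]
    exact differentiableAt_chartOperator hN
  have hV0' : ∀ᶠ y in 𝓝 (extChartAt 𝓘(ℝ, E) x x),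
      fderiv ℝ (chartMap Q E f x) y (chartField x V y) = 0 := by
    filter_upwards [eventually_mem_charts (Q := Q) (hfd x).continuousAt] with y ⟨hy, hy'⟩
    rw [fderiv_chartMap_chartField hfd hy hy', hV0]
    exact map_zero _
  have h := fderiv_lieBracket_of_vertical ((contDiffAt_chartMap (hf x)).of_le ENat.LEInfty.out) hNd
    (differentiableAt_chartField hV) (differentiableAt_chartField hW)
    (differentiableAt_chartField hW') hV0' (fderiv_chartMap_related hfd hWW')
  have hop : chartOperator (f x) N (extChartAt 𝓘(ℝ, Q) (f x) (f x)) = (N (f x) : Q →L[ℝ] Q) :=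
    ContinuousLinearMap.ext (chartOperator_self (f x) N)
  rw [chartMap_self, ← mlieBracket_eq_chartField, ← mlieBracket_eq_chartField,
    fderiv_chartMap_self (hfd x), hop] at h
  exact h

end Charts

/-! ### Tangents to immersed images, and descent on manifolds -/

section Submersion

open Filter Topology Set Asymptotics

/-- A vector that is tangent at `i z₀` to a curve in the image of an immersion `i` lies in the range
of the differential. -/
theorem HasFDerivAt.mem_range_of_curve {E : Type*} [NormedAddCommGroup E] [NormedSpace ℝ E]
    [CompleteSpace E] {F : Type*} [NormedAddCommGroup F] [NormedSpace ℝ F] [CompleteSpace F]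
    {i : F → E} {i' : F →L[ℝ] E} {z₀ : F} (hi : HasFDerivAt i i' z₀)
    (hinj : Function.Injective i') (hclosed : IsClosed (range i')) {z : ℝ → F} {v : E}
    (hz : Tendsto z (𝓝 0) (𝓝 z₀))
    (hv : (fun t : ℝ => i (z t) - i z₀ - t • v) =o[𝓝 0] fun t : ℝ => t) : v ∈ range i' := by
  -- An injective operator with closed range is bounded below, so z t - z₀ is controlled by i(z t) -
  -- i z₀. No differentiability of z is required.
  obtain ⟨C, hC⟩ := i'.antilipschitz_of_injective_of_isClosed_range hinj hclosed
  have h1 : (fun t => z t - z₀) =O[𝓝 0] fun t => i (z t) - i z₀ :=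
    (hi.isTheta_sub (hC.isInducing i'.continuous)).isBigO_symm.comp_tendsto hz
  have h2 : (fun t : ℝ => i (z t) - i z₀) =O[𝓝 0] fun t : ℝ => t := by
    have : (fun t : ℝ => t • v) =O[𝓝 0] fun t : ℝ => t :=
      IsBigO.of_bound ‖v‖ (.of_forall fun t => by rw [norm_smul, mul_comm])
    exact (hv.isBigO.add this).congr_left fun t => by abel
  have h3 : (fun t : ℝ => i (z t) - i z₀ - i' (z t - z₀)) =o[𝓝 0] fun t : ℝ => t :=
    (hi.isLittleO.comp_tendsto hz).trans_isBigO (h1.trans h2)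
  have h4 : (fun t : ℝ => i' (z t - z₀) - t • v) =o[𝓝 0] fun t : ℝ => t :=
    (hv.sub h3).congr_left fun t => by abel
  have h5 : Tendsto (fun t : ℝ => t⁻¹ • (i' (z t - z₀) - t • v)) (𝓝[≠] 0) (𝓝 0) := by
    have := (h4.mono (nhdsWithin_le_nhds (s := {0}ᶜ))).norm_left.norm_right.tendsto_div_nhds_zero
    rw [tendsto_zero_iff_norm_tendsto_zero]
    refine this.congr fun t => ?_
    rw [norm_smul, norm_inv, div_eq_inv_mul]
  have h6 : Tendsto (fun t : ℝ => i' (t⁻¹ • (z t - z₀))) (𝓝[≠] 0) (𝓝 v) := by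
    have h7 := h5.add_const v
    rw [zero_add] at h7
    refine h7.congr' ?_
    filter_upwards [self_mem_nhdsWithin] with t ht
    rw [smul_sub, smul_smul, inv_mul_cancel₀ ht, one_smul, map_smul]
    abel
  -- The vector v is a limit of the vectors i'(t⁻¹(z t - z₀)), and the range is closed.
  rw [← hclosed.closure_eq]
  exact mem_closure_of_tendsto h6 (.of_forall fun t => mem_range_self _)

universe u v w

variable {E : Type u} [NormedAddCommGroup E] [NormedSpace ℝ E] [CompleteSpace E]
  {Q : Type v} [NormedAddCommGroup Q] [NormedSpace ℝ Q] [CompleteSpace Q]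
  {H : Type*} [TopologicalSpace H] [ChartedSpace E H] [IsManifold 𝓘(ℝ, E) ∞ H]
  {M : Type*} [TopologicalSpace M] [ChartedSpace Q M] [IsManifold 𝓘(ℝ, Q) ∞ M]
  {f : H → M} {x : H}

omit [CompleteSpace E] [CompleteSpace Q] in
theorem eventually_surjective_fderiv_chartMap (hf : MDifferentiable 𝓘(ℝ, E) 𝓘(ℝ, Q) f)
    (hsurj : ∀ z, Function.Surjective (mfderiv 𝓘(ℝ, E) 𝓘(ℝ, Q) f z)) :
    ∀ᶠ y in 𝓝 (extChartAt 𝓘(ℝ, E) x x),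
      Function.Surjective (fderiv ℝ (chartMap Q E f x) y) := by
  filter_upwards [eventually_mem_charts (Q := Q) (hf x).continuousAt] with y ⟨hy, hy'⟩
  intro q
  obtain ⟨w, hw⟩ := (isInvertible_mfderiv_extChartAt (I := 𝓘(ℝ, Q)) hy').bijective.surjective q
  obtain ⟨u, rfl⟩ := hsurj _ w
  refine ⟨chartDeriv x y u, ?_⟩
  rw [fderiv_chartMap hf hy hy', chartSymmDeriv_chartDeriv hy]
  exact hw

/-- Continuity of h is needed separately so that h can be read in a chart of the target. Used for
the translations α_g. -/
theorem MDifferentiableAt.of_comp_submersion {W : Type*} [NormedAddCommGroup W] [NormedSpace ℝ W]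
    {P : Type*} [TopologicalSpace P] [ChartedSpace W P]
    (hf : ContMDiff 𝓘(ℝ, E) 𝓘(ℝ, Q) ∞ f)
    (hsurj : ∀ z, Function.Surjective (mfderiv 𝓘(ℝ, E) 𝓘(ℝ, Q) f z)) {h : M → P}
    (hc : ContinuousAt h (f x))
    (hF : MDifferentiableAt 𝓘(ℝ, E) 𝓘(ℝ, W) (fun z => h (f z)) x) :
    MDifferentiableAt 𝓘(ℝ, Q) 𝓘(ℝ, W) h (f x) := by
  have hfd : MDifferentiable 𝓘(ℝ, E) 𝓘(ℝ, Q) f := hf.mdifferentiable (by simp)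
  have hstrict : HasStrictFDerivAt (chartMap Q E f x)
      (fderiv ℝ (chartMap Q E f x) (extChartAt 𝓘(ℝ, E) x x)) (extChartAt 𝓘(ℝ, E) x x) :=
    (contDiffAt_chartMap (hf x)).hasStrictFDerivAt (by simp)
  have hFc : DifferentiableAt ℝ (chartMap W E (fun z => h (f z)) x) (extChartAt 𝓘(ℝ, E) x x) := by
    have := (mdifferentiableAt_iff _ _).1 hF |>.2
    rw [← differentiableWithinAt_univ]
    unfold chartMap
    simpa [Function.comp_def, writtenInExtChartAt] using this
  have hcomp : DifferentiableAt ℝ (fun y => chartMap W Q h (f x) (chartMap Q E f x y))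
      (extChartAt 𝓘(ℝ, E) x x) := by
    refine hFc.congr_of_eventuallyEq ?_
    filter_upwards [eventually_mem_charts (Q := Q) (hfd x).continuousAt] with y ⟨hy, hy'⟩
    simp only [chartMap]
    rw [(extChartAt 𝓘(ℝ, Q) (f x)).left_inv hy']
  have hres := hstrict.differentiableAt_of_comp
    (eventually_surjective_fderiv_chartMap hfd hsurj).self_of_nhds hcomp
  rw [chartMap_self] at hres
  rw [mdifferentiableAt_iff]
  refine ⟨hc, ?_⟩
  have hr := hres.differentiableWithinAt (s := range 𝓘(ℝ, Q))
  exact hr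

/-- A vector-space target suffices here: it is applied to the fibre coordinate of a vector field in
a trivialization. -/
theorem ContMDiffAt.of_comp_submersion {W : Type v} [NormedAddCommGroup W] [NormedSpace ℝ W]
    (hf : ContMDiff 𝓘(ℝ, E) 𝓘(ℝ, Q) ∞ f)
    (hsurj : ∀ z, Function.Surjective (mfderiv 𝓘(ℝ, E) 𝓘(ℝ, Q) f z)) {h : M → W}
    (hF : ContMDiffAt 𝓘(ℝ, E) 𝓘(ℝ, W) ∞ (fun z => h (f z)) x) :
    ContMDiffAt 𝓘(ℝ, Q) 𝓘(ℝ, W) ∞ h (f x) := by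
  have hfd : MDifferentiable 𝓘(ℝ, E) 𝓘(ℝ, Q) f := hf.mdifferentiable (by simp)
  rw [contMDiffAt_infty] at hF ⊢
  intro n
  have hFc := contDiffAt_chartMap (hF n)
  have hcomp : ContDiffAt ℝ n (fun y => chartMap W Q h (f x) (chartMap Q E f x y))
      (extChartAt 𝓘(ℝ, E) x x) := by
    refine hFc.congr_of_eventuallyEq ?_
    filter_upwards [eventually_mem_charts (Q := Q) (hfd x).continuousAt] with y ⟨hy, hy'⟩
    simp only [chartMap]
    rw [(extChartAt 𝓘(ℝ, Q) (f x)).left_inv hy']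
  have hres := (contDiffAt_chartMap (hf x)).of_comp_submersion
    (eventually_surjective_fderiv_chartMap hfd hsurj) n hcomp
  rw [chartMap_self] at hres
  have hM : ContMDiffAt 𝓘(ℝ, Q) 𝓘(ℝ, W) n
      (fun q => chartMap W Q h (f x) (extChartAt 𝓘(ℝ, Q) (f x) q)) (f x) :=
    hres.contMDiffAt.comp (f x) contMDiffAt_extChartAt
  refine hM.congr_of_eventuallyEq ?_
  filter_upwards [extChartAt_source_mem_nhds (I := 𝓘(ℝ, Q)) (f x)] with q hq
  simp only [chartMap]
  rw [(extChartAt 𝓘(ℝ, Q) (f x)).left_inv hq, extChartAt_model_space_eq_id]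
  rfl

end Submersion

/-! ### Kernel of π_*, invariant fields and fundamental fields -/

section HomogeneousSpace

open Filter Topology Set Asymptotics VectorField

variable {E : Type*} [NormedAddCommGroup E] [NormedSpace ℝ E] [CompleteSpace E]
  {F : Type*} [NormedAddCommGroup F] [NormedSpace ℝ F] [CompleteSpace F]
  {Q : Type*} [NormedAddCommGroup Q] [NormedSpace ℝ Q] [CompleteSpace Q]
  {G : Type*} [TopologicalSpace G] [ChartedSpace E G] [Group G] [LieGroup 𝓘(ℝ, E) ∞ G]
  {K : Subgroup G} [ChartedSpace F K] [ChartedSpace Q (G ⧸ K)]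
  [IsManifold 𝓘(ℝ, Q) ∞ (G ⧸ K)]

local notation "dπ" => mfderiv 𝓘(ℝ, E) 𝓘(ℝ, Q) (fun g : G => (g : G ⧸ K))

omit [CompleteSpace E] [CompleteSpace F] [CompleteSpace Q] [LieGroup 𝓘(ℝ, E) ∞ G]
  [IsManifold 𝓘(ℝ, Q) ∞ (G ⧸ K)] in
/-- `𝔨` is contained in the kernel of `π_{*1}`. -/
theorem IsHomogeneousSpace.mfderiv_eq_zero (hGK : IsHomogeneousSpace E Q K)
    (hK : IsBanachLieSubgroup (E := E) (F := F) K) {v : GroupLieAlgebra 𝓘(ℝ, E) G}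
    (hv : v ∈ subgroupLieAlgebra E F K) : dπ 1 v = 0 := by
  obtain ⟨u, rfl⟩ := hv
  have h1 : MDifferentiableAt 𝓘(ℝ, F) 𝓘(ℝ, E) (fun k : K => (k : G)) 1 :=
    (hK.smooth_incl 1).mdifferentiableAt (by simp)
  have h2 : MDifferentiableAt 𝓘(ℝ, E) 𝓘(ℝ, Q) (fun g : G => (g : G ⧸ K)) ((1 : K) : G) :=
    (hGK.smooth_mk _).mdifferentiableAt (by simp)
  have h3 := mfderiv_comp (1 : K) h2 h1
  have h4 : (fun g : G => (g : G ⧸ K)) ∘ (fun k : K => (k : G)) = fun _ => ((1 : G) : G ⧸ K) := by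
    ext k
    exact QuotientGroup.eq.2 (by simp)
  have h5 : HasMFDerivAt 𝓘(ℝ, F) 𝓘(ℝ, Q)
      ((fun g : G => (g : G ⧸ K)) ∘ (fun k : K => (k : G))) 1 (0 : F →L[ℝ] Q) := by
    rw [h4]
    exact hasMFDerivAt_const _ _
  have h6 := h5.mfderiv
  exact DFunLike.congr_fun (h3.symm.trans h6) u

/-- The kernel of `π_{*1}` is contained in `𝔨`. -/
theorem IsHomogeneousSpace.mem_subgroupLieAlgebra (hGK : IsHomogeneousSpace E Q K)
    (hK : IsBanachLieSubgroup (E := E) (F := F) K) {v : GroupLieAlgebra 𝓘(ℝ, E) G}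
    (hv : dπ 1 v = 0) : v ∈ subgroupLieAlgebra E F K := by
  let p : G → G ⧸ K := fun g => (g : G ⧸ K)
  have hpd : MDifferentiable 𝓘(ℝ, E) 𝓘(ℝ, Q) p := hGK.smooth_mk.mdifferentiable (by simp)
  let a : E := extChartAt 𝓘(ℝ, E) (1 : G) 1
  let v' : E := v
  have hp : HasStrictFDerivAt (chartMap Q E p 1) (fderiv ℝ (chartMap Q E p 1) a) a :=
    (contDiffAt_chartMap (hGK.smooth_mk 1)).hasStrictFDerivAt (by simp)
  have hpv : fderiv ℝ (chartMap Q E p 1) a v' = 0 := by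
    rw [fderiv_chartMap_self (hpd 1)]
    exact hv
  obtain ⟨C, -, hC⟩ := hp.exists_preimage_norm_sub_le
    (eventually_surjective_fderiv_chartMap hpd hGK.surjective_mfderiv).self_of_nhds
  have hline : HasDerivAt (fun t : ℝ => a + t • v') v' 0 := by
    simpa using ((hasDerivAt_id (0 : ℝ)).smul_const v').const_add a
  have hl0 : (fun t : ℝ => a + t • v') 0 = a := by simp
  have hlt : Tendsto (fun t : ℝ => a + t • v') (𝓝 0) (𝓝 a) := by
    simpa using hline.continuousAt.tendsto
  have hft : (fun t : ℝ => chartMap Q E p 1 (a + t • v') - chartMap Q E p 1 a) =o[𝓝 0]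
      fun t : ℝ => t := by
    have h1 := (hl0.symm ▸ hp.hasFDerivAt : HasFDerivAt (chartMap Q E p 1)
      (fderiv ℝ (chartMap Q E p 1) a) ((fun t : ℝ => a + t • v') 0)).comp_hasDerivAt (0 : ℝ) hline
    rw [hpv] at h1
    simpa [hasDerivAt_iff_isLittleO] using h1
  have hpair : Tendsto (fun t : ℝ => (a + t • v', chartMap Q E p 1 a)) (𝓝 0)
      (𝓝 (a, chartMap Q E p 1 a)) := hlt.prodMk_nhds tendsto_const_nhds
  -- Metric regularity corrects the line a + tv to a curve lying exactly in the fibre of π. The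
  -- correction is O(‖π(a + tv) - π(a)‖) in charts, hence o(t), since π_* v = 0.
  obtain ⟨x, hx⟩ : ∃ x : ℝ → E, ∀ᶠ t in 𝓝 (0 : ℝ), chartMap Q E p 1 (x t) = chartMap Q E p 1 a ∧
      ‖x t - (a + t • v')‖ ≤ C * ‖chartMap Q E p 1 a - chartMap Q E p 1 (a + t • v')‖ := by
    classical
    refine ⟨fun t => if ht : ∃ x, chartMap Q E p 1 x = chartMap Q E p 1 a ∧
      ‖x - (a + t • v')‖ ≤ C * ‖chartMap Q E p 1 a - chartMap Q E p 1 (a + t • v')‖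
      then ht.choose else a, ?_⟩
    filter_upwards [hpair.eventually hC] with t ht
    rw [dif_pos ht]
    exact ht.choose_spec
  have hxo : (fun t : ℝ => x t - a - t • v') =o[𝓝 0] fun t : ℝ => t := by
    refine IsBigO.trans_isLittleO (IsBigO.of_bound C ?_) hft
    filter_upwards [hx] with t ht
    rw [norm_sub_rev (chartMap Q E p 1 (a + t • v')), sub_sub]
    exact ht.2
  have hxt : Tendsto x (𝓝 0) (𝓝 a) := by
    have h1 : Tendsto (fun t : ℝ => x t - a - t • v') (𝓝 0) (𝓝 0) :=
      hxo.trans_tendsto tendsto_id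
    have h2 := h1.add hlt
    rw [zero_add] at h2
    exact h2.congr fun t => by abel
  let k : ℝ → G := fun t => (extChartAt 𝓘(ℝ, E) (1 : G)).symm (x t)
  have hkt : Tendsto k (𝓝 0) (𝓝 1) := by
    have h1 : ContinuousAt (extChartAt 𝓘(ℝ, E) (1 : G)).symm a := continuousAt_extChartAt_symm 1
    have h2 := h1.tendsto.comp hxt
    rwa [extChartAt_to_inv] at h2
  have hkK : ∀ᶠ t in 𝓝 (0 : ℝ), k t ∈ K := by
    filter_upwards [hx, hxt.eventually (eventually_mem_charts (Q := Q) (hpd 1).continuousAt)]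
      with t ht ht'
    have h1 : extChartAt 𝓘(ℝ, Q) (p 1) (p (k t)) = extChartAt 𝓘(ℝ, Q) (p 1) (p 1) :=
      ht.1.trans chartMap_self
    have h2 : p (k t) = p 1 :=
      (extChartAt 𝓘(ℝ, Q) (p 1)).injOn ht'.2 (mem_extChartAt_source (p 1)) h1
    have h3 : (1 : G)⁻¹ * k t ∈ K := QuotientGroup.eq.1 h2.symm
    simpa using h3
  classical
  -- The value 1 off K is irrelevant, as k t lies in K for small t. Continuity of κ at 0 uses that K
  -- carries the subspace topology.
  let κ : ℝ → K := fun t => if ht : k t ∈ K then ⟨k t, ht⟩ else 1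
  have hκ : ∀ᶠ t in 𝓝 (0 : ℝ), (κ t : G) = k t := by
    filter_upwards [hkK] with t ht
    simp [κ, ht]
  have hκt : Tendsto κ (𝓝 0) (𝓝 1) := by
    rw [tendsto_subtype_rng]
    exact hkt.congr' (hκ.mono fun t ht => ht.symm)
  let ι : K → G := fun k => (k : G)
  have hι : MDifferentiableAt 𝓘(ℝ, F) 𝓘(ℝ, E) ι 1 := (hK.smooth_incl 1).mdifferentiableAt (by simp)
  have hder : HasFDerivAt (chartMap E F ι 1) (mfderiv 𝓘(ℝ, F) 𝓘(ℝ, E) ι 1 : F →L[ℝ] E)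
      (extChartAt 𝓘(ℝ, F) (1 : K) 1) := by
    rw [← fderiv_chartMap_self hι]
    exact ((contDiffAt_chartMap (hK.smooth_incl 1)).differentiableAt (by simp)).hasFDerivAt
  have hz : Tendsto (fun t => extChartAt 𝓘(ℝ, F) (1 : K) (κ t)) (𝓝 0)
      (𝓝 (extChartAt 𝓘(ℝ, F) (1 : K) 1)) :=
    (continuousAt_extChartAt (I := 𝓘(ℝ, F)) (1 : K)).tendsto.comp hκt
  have hιx : ∀ᶠ t in 𝓝 (0 : ℝ),
      chartMap E F ι 1 (extChartAt 𝓘(ℝ, F) (1 : K) (κ t)) = x t := by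
    filter_upwards [hκ, hκt.eventually (extChartAt_source_mem_nhds (I := 𝓘(ℝ, F)) (1 : K)),
      hxt.eventually (extChartAt_target_mem_nhds (I := 𝓘(ℝ, E)) (1 : G))] with t h1 h2 h3
    show extChartAt 𝓘(ℝ, E) (1 : G) (ι _) = x t
    rw [(extChartAt 𝓘(ℝ, F) (1 : K)).left_inv h2]
    show extChartAt 𝓘(ℝ, E) (1 : G) (κ t : G) = x t
    rw [h1]
    exact (extChartAt 𝓘(ℝ, E) (1 : G)).right_inv h3
  have hmem := hder.mem_range_of_curve (hK.injective_mfderiv 1) (hK.isClosed_range_mfderiv 1) hz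
    (v := v') (by
      refine hxo.congr' ?_ .rfl
      filter_upwards [hιx] with t ht
      rw [ht, chartMap_self]
      rfl)
  exact hmem

omit [CompleteSpace E] [CompleteSpace Q] [LieGroup 𝓘(ℝ, E) ∞ G]
  [IsManifold 𝓘(ℝ, Q) ∞ (G ⧸ K)] in
theorem mfderiv_mk_congr {g g' : G} (h : g' = g) (w : E) :
    (dπ g' : E →L[ℝ] Q) w = (dπ g : E →L[ℝ] Q) w := by
  rw [h]

/-- Descends from α_g ∘ π = π ∘ L_g, whose right-hand side is smooth. -/
theorem IsHomogeneousSpace.mdifferentiableAt_smul (hGK : IsHomogeneousSpace E Q K) (g h : G) :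
    MDifferentiableAt 𝓘(ℝ, Q) 𝓘(ℝ, Q) (fun q : G ⧸ K => g • q) (h : G ⧸ K) := by
  have : IsTopologicalGroup G := topologicalGroup_of_lieGroup 𝓘(ℝ, E) ∞
  refine MDifferentiableAt.of_comp_submersion hGK.smooth_mk hGK.surjective_mfderiv
    (continuous_const_smul g).continuousAt ?_
  have h1 : ContMDiff 𝓘(ℝ, E) 𝓘(ℝ, Q) ∞ (fun z : G => ((g * z : G) : G ⧸ K)) :=
    hGK.smooth_mk.comp contMDiff_mul_left
  exact (h1 h).mdifferentiableAt (by simp)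

/-- `(α_g)_* π_{*1} v = π_{*g} (L_g)_* v`. -/
theorem IsHomogeneousSpace.mfderiv_smul_mk (hGK : IsHomogeneousSpace E Q K) (g : G)
    (v : GroupLieAlgebra 𝓘(ℝ, E) G) :
    (mfderiv 𝓘(ℝ, Q) 𝓘(ℝ, Q) (fun q : G ⧸ K => g • q) ((1 : G) : G ⧸ K) (dπ 1 v) : Q) =
      dπ g (mulInvariantVectorField v g) := by
  have hp : ∀ z, MDifferentiableAt 𝓘(ℝ, E) 𝓘(ℝ, Q) (fun g : G => (g : G ⧸ K)) z :=
    hGK.smooth_mk.mdifferentiable (by simp)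
  have h1 := mfderiv_comp (1 : G) (hGK.mdifferentiableAt_smul g 1) (hp 1)
  have hL : MDifferentiableAt 𝓘(ℝ, E) 𝓘(ℝ, E) (fun z : G => g * z) 1 :=
    (contMDiff_mul_left (n := ∞) (1 : G)).mdifferentiableAt (by simp)
  have h2 := mfderiv_comp (1 : G) (hp (g * 1)) hL
  have h3 := DFunLike.congr_fun (h1.symm.trans h2) v
  exact h3.trans (mfderiv_mk_congr (mul_one g) _)

omit [CompleteSpace F] in
/-- Left invariant vector fields defined by elements of `𝔨` are vertical. -/
theorem IsHomogeneousSpace.mfderiv_mulInvariantVectorField_eq_zero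
    (hGK : IsHomogeneousSpace E Q K) (hK : IsBanachLieSubgroup (E := E) (F := F) K)
    {v : GroupLieAlgebra 𝓘(ℝ, E) G} (hv : v ∈ subgroupLieAlgebra E F K) (g : G) :
    dπ g (mulInvariantVectorField v g) = 0 := by
  refine (hGK.mfderiv_smul_mk g v).symm.trans ?_
  rw [hGK.mfderiv_eq_zero hK hv]
  exact map_zero _

/-- The condition at p₀ is transported by α_g, using that α_g ∘ π = π ∘ L_g. This is the relation
that lets the torsion be computed with left-invariant fields. -/
theorem IsInducedBy.mfderiv_mulInvariantVectorField (hGK : IsHomogeneousSpace E Q K)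
    {J : GroupLieAlgebra 𝓘(ℝ, E) G →L[ℝ] GroupLieAlgebra 𝓘(ℝ, E) G}
    {N : ∀ p : G ⧸ K, TangentSpace 𝓘(ℝ, Q) p →L[ℝ] TangentSpace 𝓘(ℝ, Q) p}
    (hind : IsInducedBy N J) (v : GroupLieAlgebra 𝓘(ℝ, E) G) (g : G) :
    dπ g (mulInvariantVectorField (J v) g) = N (g : G ⧸ K) (dπ g (mulInvariantVectorField v g)) := by
  have hN : ∀ q : G ⧸ K, q = (g : G ⧸ K) → ∀ w : Q, (N q w : Q) = N (g : G ⧸ K) w := by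
    rintro q rfl w
    rfl
  have h1 := hind.transport g (dπ 1 v)
  rw [hind.at_base] at h1
  have h2 := hN (g • ((1 : G) : G ⧸ K)) (congrArg _ (mul_one g))
    (mfderiv 𝓘(ℝ, Q) 𝓘(ℝ, Q) (fun q : G ⧸ K => g • q) ((1 : G) : G ⧸ K) (dπ 1 v))
  have h3 := hGK.mfderiv_smul_mk g v
  have h4 := hGK.mfderiv_smul_mk g (J v)
  refine h4.symm.trans (h1.symm.trans (h2.trans ?_))
  exact congrArg (N (g : G ⧸ K)) h3

omit [CompleteSpace E] [CompleteSpace Q] [IsManifold 𝓘(ℝ, Q) ∞ (G ⧸ K)] in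
theorem IsHomogeneousSpace.exists_mulInvariantVectorField (hGK : IsHomogeneousSpace E Q K) (g : G)
    (x : TangentSpace 𝓘(ℝ, Q) (g : G ⧸ K)) :
    ∃ v : GroupLieAlgebra 𝓘(ℝ, E) G, x = dπ g (mulInvariantVectorField v g) := by
  obtain ⟨u, rfl⟩ := hGK.surjective_mfderiv g x
  have h1 : MDifferentiableAt 𝓘(ℝ, E) 𝓘(ℝ, E) (fun z : G => g⁻¹ * z) g :=
    (contMDiff_mul_left (n := ∞) g).mdifferentiableAt (by simp)
  have h2 : MDifferentiableAt 𝓘(ℝ, E) 𝓘(ℝ, E) (fun z : G => g * z) (g⁻¹ * g) :=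
    (contMDiff_mul_left (n := ∞) (g⁻¹ * g)).mdifferentiableAt (by simp)
  have h3 := mfderiv_comp g h2 h1
  have h4 : (fun z : G => g * z) ∘ (fun z : G => g⁻¹ * z) = id := by
    ext z
    simp
  have h5 : HasMFDerivAt 𝓘(ℝ, E) 𝓘(ℝ, E) ((fun z : G => g * z) ∘ (fun z : G => g⁻¹ * z)) g
      (ContinuousLinearMap.id ℝ E) := by
    rw [h4]
    exact hasMFDerivAt_id g
  have h6 := DFunLike.congr_fun (h5.mfderiv.symm.trans h3) u
  have h7 : ∀ z : G, z = 1 → ∀ w : E,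
      (mfderiv 𝓘(ℝ, E) 𝓘(ℝ, E) (fun z : G => g * z) z : E →L[ℝ] E) w =
        (mfderiv 𝓘(ℝ, E) 𝓘(ℝ, E) (fun z : G => g * z) 1 : E →L[ℝ] E) w := by
    rintro z rfl w
    rfl
  refine ⟨(mfderiv 𝓘(ℝ, E) 𝓘(ℝ, E) (fun z : G => g⁻¹ * z) g : E →L[ℝ] E) u, ?_⟩
  exact congrArg (dπ g) (h6.trans (h7 _ (inv_mul_cancel g) _))

/-- The fundamental vector field on `G ⧸ K` defined by an element of the Lie algebra of `G`. -/
def fundamentalVectorField (v : GroupLieAlgebra 𝓘(ℝ, E) G) (q : G ⧸ K) : TangentSpace 𝓘(ℝ, Q) q :=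
  (mfderiv 𝓘(ℝ, E) 𝓘(ℝ, Q) (fun g : G => g • q) 1 : E →L[ℝ] Q) v

omit [CompleteSpace E] [CompleteSpace Q] [LieGroup 𝓘(ℝ, E) ∞ G]
  [IsManifold 𝓘(ℝ, Q) ∞ (G ⧸ K)] in
theorem IsHomogeneousSpace.fundamentalVectorField_one (v : GroupLieAlgebra 𝓘(ℝ, E) G) :
    (fundamentalVectorField v ((1 : G) : G ⧸ K) : TangentSpace 𝓘(ℝ, Q) ((1 : G) : G ⧸ K)) =
      dπ 1 v := by
  have h : (fun g : G => g • ((1 : G) : G ⧸ K)) = fun g : G => (g : G ⧸ K) := by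
    ext g
    exact congrArg _ (mul_one g)
  have h' : ∀ f : G → G ⧸ K, f = (fun g : G => (g : G ⧸ K)) →
      ((mfderiv 𝓘(ℝ, E) 𝓘(ℝ, Q) f 1 : E →L[ℝ] Q) v : Q) = (dπ 1 : E →L[ℝ] Q) v := by
    rintro _ rfl
    rfl
  exact h' _ h

theorem IsHomogeneousSpace.isSmoothVectorField_fundamentalVectorField
    (hGK : IsHomogeneousSpace E Q K) (v : GroupLieAlgebra 𝓘(ℝ, E) G) :
    IsSmoothVectorField (fundamentalVectorField v : ∀ q : G ⧸ K, TangentSpace 𝓘(ℝ, Q) q) := by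
  let Ψ : G × G → G ⧸ K := fun z => ((z.1 * z.2 : G) : G ⧸ K)
  have hΨ : ContMDiff (𝓘(ℝ, E).prod 𝓘(ℝ, E)) 𝓘(ℝ, Q) ∞ Ψ :=
    hGK.smooth_mk.comp (contMDiff_mul 𝓘(ℝ, E) ∞)
  let f₀ : G → TangentBundle 𝓘(ℝ, E) G := fun g => Bundle.TotalSpace.mk' E g 0
  have h₀ : ContMDiff 𝓘(ℝ, E) 𝓘(ℝ, E).tangent ∞ f₀ := Bundle.contMDiff_zeroSection _ _
  let f₁ : G → TangentBundle 𝓘(ℝ, E) G := fun _ => Bundle.TotalSpace.mk' E 1 v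
  have h₁ : ContMDiff 𝓘(ℝ, E) 𝓘(ℝ, E).tangent ∞ f₁ := contMDiff_const
  have hS := ((hΨ.contMDiff_tangentMap (m := ∞) (by simp)).comp
    (contMDiff_equivTangentBundleProd_symm (n := ∞) (I := 𝓘(ℝ, E)) (M := G) (I' := 𝓘(ℝ, E))
      (M' := G))).comp (h₁.prodMk h₀)
  have hlift : ContMDiff 𝓘(ℝ, E) 𝓘(ℝ, Q).tangent ∞ (fun h : G =>
      (⟨(h : G ⧸ K), fundamentalVectorField v (h : G ⧸ K)⟩ : TangentBundle 𝓘(ℝ, Q) (G ⧸ K))) := by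
    refine hS.congr fun h => ?_
    have hcongr : ∀ (q : G ⧸ K) (w w' : Q), q = (h : G ⧸ K) → w = w' →
        (⟨(h : G ⧸ K), w'⟩ : TangentBundle 𝓘(ℝ, Q) (G ⧸ K)) = ⟨q, w⟩ := by
      rintro _ w _ rfl rfl
      rfl
    refine hcongr _ _ _ (congrArg _ (one_mul h)) ?_
    have h2 := mfderiv_prod_eq_add_apply (hΨ.mdifferentiableAt (by simp) (x := (1, h)))
      (v := ((v, 0) : E × E))
    have h3 : ∀ A B : E →L[ℝ] Q, A v + B 0 = A v := by simp
    exact h2.trans (h3 _ _)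
  intro p
  obtain ⟨g, rfl⟩ := QuotientGroup.mk_surjective p
  rw [Bundle.contMDiffAt_section]
  refine ContMDiffAt.of_comp_submersion (f := fun g : G => (g : G ⧸ K)) (x := g) hGK.smooth_mk hGK.surjective_mfderiv ?_
  exact (Bundle.contMDiffAt_totalSpace.1 (hlift g)).2

end HomogeneousSpace

/-! ### Real and imaginary parts in the complexification -/

section Complexification

variable {L : Type*} [AddCommGroup L] [Module ℝ L]

/-- The real part of an element of `ℂ ⊗ L`. -/
def tensorRe : ℂ ⊗[ℝ] L →ₗ[ℝ] L :=
  (TensorProduct.lid ℝ L).toLinearMap ∘ₗ LinearMap.rTensor L Complex.reLm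

/-- The imaginary part of an element of `ℂ ⊗ L`. -/
def tensorIm : ℂ ⊗[ℝ] L →ₗ[ℝ] L :=
  (TensorProduct.lid ℝ L).toLinearMap ∘ₗ LinearMap.rTensor L Complex.imLm

@[simp]
theorem tensorRe_tmul (c : ℂ) (x : L) : tensorRe (c ⊗ₜ[ℝ] x) = c.re • x := by
  simp [tensorRe]

@[simp]
theorem tensorIm_tmul (c : ℂ) (x : L) : tensorIm (c ⊗ₜ[ℝ] x) = c.im • x := by
  simp [tensorIm]

theorem one_tmul_tensorRe_add (z : ℂ ⊗[ℝ] L) :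
    (1 : ℂ) ⊗ₜ[ℝ] tensorRe z + Complex.I ⊗ₜ[ℝ] tensorIm z = z := by
  induction z with
  | zero => simp
  | tmul c x =>
    rw [tensorRe_tmul, tensorIm_tmul, ← TensorProduct.smul_tmul, ← TensorProduct.smul_tmul,
      ← TensorProduct.add_tmul]
    congr 1
    apply Complex.ext <;> simp
  | add z w hz hw =>
    rw [map_add, map_add, TensorProduct.tmul_add, TensorProduct.tmul_add]
    nth_rw 3 [← hz]
    nth_rw 3 [← hw]
    abel

theorem Submodule.mem_baseChange_complex_iff (k : Submodule ℝ L) (z : ℂ ⊗[ℝ] L) :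
    z ∈ k.baseChange ℂ ↔ tensorRe z ∈ k ∧ tensorIm z ∈ k := by
  constructor
  · intro hz
    obtain ⟨y, rfl⟩ := hz
    induction y with
    | zero => simp
    | tmul c x =>
      simpa using And.intro (k.smul_mem c.re x.2) (k.smul_mem c.im x.2)
    | add y w hy hw =>
      simpa using And.intro (k.add_mem hy.1 hw.1) (k.add_mem hy.2 hw.2)
  · rintro ⟨h1, h2⟩
    rw [← one_tmul_tensorRe_add z]
    exact add_mem (Submodule.tmul_mem_baseChange_of_mem _ h1)
      (Submodule.tmul_mem_baseChange_of_mem _ h2)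

/-- For z = a + ib one has (J - i)z = (Ja + b) + i(Jb - a). -/
theorem mem_comap_baseChange_iff (k : Submodule ℝ L) (J : L →ₗ[ℝ] L) (z : ℂ ⊗[ℝ] L) :
    z ∈ (k.baseChange ℂ).comap (J.baseChange ℂ - Complex.I • LinearMap.id) ↔
      J (tensorRe z) + tensorIm z ∈ k ∧ J (tensorIm z) - tensorRe z ∈ k := by
  rw [Submodule.mem_comap, Submodule.mem_baseChange_complex_iff]
  have h : (J.baseChange ℂ - Complex.I • LinearMap.id : ℂ ⊗[ℝ] L →ₗ[ℂ] ℂ ⊗[ℝ] L) z =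
      (1 : ℂ) ⊗ₜ[ℝ] (J (tensorRe z) + tensorIm z) +
        Complex.I ⊗ₜ[ℝ] (J (tensorIm z) - tensorRe z) := by
    nth_rw 1 [← one_tmul_tensorRe_add z]
    simp [TensorProduct.tmul_add, TensorProduct.tmul_sub, TensorProduct.smul_tmul',
      TensorProduct.neg_tmul]
    abel
  rw [h]
  simp

end Complexification

/-! ### Algebraic torsion and the subalgebra condition -/

section LieAlgebra

variable {L : Type*} [LieRing L] [LieAlgebra ℝ L]

theorem tensorRe_lie (z w : ℂ ⊗[ℝ] L) :
    tensorRe ⁅z, w⁆ = ⁅tensorRe z, tensorRe w⁆ - ⁅tensorIm z, tensorIm w⁆ := by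
  nth_rw 1 [← one_tmul_tensorRe_add z, ← one_tmul_tensorRe_add w]
  simp [sub_eq_add_neg]

theorem tensorIm_lie (z w : ℂ ⊗[ℝ] L) :
    tensorIm ⁅z, w⁆ = ⁅tensorRe z, tensorIm w⁆ + ⁅tensorIm z, tensorRe w⁆ := by
  nth_rw 1 [← one_tmul_tensorRe_add z, ← one_tmul_tensorRe_add w]
  simp [add_comm]

/-- The algebraic Nijenhuis torsion of `J` takes values in `k` if and only if the complex subspace
`{v | (J - i) v ∈ k^ℂ}` is a subalgebra. -/
theorem lie_mem_comap_baseChange_iff (k : Submodule ℝ L) (J : L →ₗ[ℝ] L)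
    (hJk : ∀ v ∈ k, J v ∈ k) (hJ : ∀ v, J (J v) + v ∈ k)
    (hkJ : ∀ u ∈ k, ∀ w, ⁅u, J w⁆ - J ⁅u, w⁆ ∈ k) (hkk : ∀ u ∈ k, ∀ w ∈ k, ⁅u, w⁆ ∈ k) :
    (∀ v w : L, J ⁅J v, w⁆ + J ⁅v, J w⁆ - ⁅J v, J w⁆ - J (J ⁅v, w⁆) ∈ k) ↔
      ∀ v ∈ (k.baseChange ℂ).comap (J.baseChange ℂ - Complex.I • LinearMap.id),
        ∀ w ∈ (k.baseChange ℂ).comap (J.baseChange ℂ - Complex.I • LinearMap.id),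
          ⁅v, w⁆ ∈ (k.baseChange ℂ).comap (J.baseChange ℂ - Complex.I • LinearMap.id) := by
  constructor
  · intro h z hz z' hz'
    rw [mem_comap_baseChange_iff] at hz hz' ⊢
    rw [tensorRe_lie, tensorIm_lie]
    -- An element of Z₊ is a + i(m - Ja) with m in k, so everything is expressed through a, a' and
    -- errors in k.
    obtain ⟨m, hm, hb⟩ : ∃ m ∈ k, tensorIm z = m - J (tensorRe z) := ⟨_, hz.1, by abel⟩
    obtain ⟨m', hm', hb'⟩ : ∃ m ∈ k, tensorIm z' = m - J (tensorRe z') := ⟨_, hz'.1, by abel⟩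
    rw [hb, hb']
    generalize tensorRe z = a
    generalize tensorRe z' = a'
    have h2 : J (⁅a, m' - J a'⁆ + ⁅m - J a, a'⁆) - (⁅a, a'⁆ - ⁅m - J a, m' - J a'⁆) ∈ k := by
      have e : J (⁅a, m' - J a'⁆ + ⁅m - J a, a'⁆) - (⁅a, a'⁆ - ⁅m - J a, m' - J a'⁆) =
          (⁅m', J a⁆ - J ⁅m', a⁆) + ⁅m, m'⁆ - (⁅m, J a'⁆ - J ⁅m, a'⁆) - (J (J ⁅a, a'⁆) + ⁅a, a'⁆)
            - (J ⁅J a, a'⁆ + J ⁅a, J a'⁆ - ⁅J a, J a'⁆ - J (J ⁅a, a'⁆)) := by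
        rw [← lie_skew m' a, ← lie_skew m' (J a)]
        simp only [lie_sub, sub_lie, map_add, map_sub, map_neg]
        abel
      rw [e]
      exact k.sub_mem (k.sub_mem (k.sub_mem (k.add_mem (hkJ m' hm' a) (hkk m hm m' hm'))
        (hkJ m hm a')) (hJ _)) (h a a')
    refine ⟨?_, h2⟩
    -- With R and S the real and imaginary parts of the bracket, JR + S = (J²S + S) - J(JS - R), so
    -- the first condition follows from the second.
    have h3 := k.sub_mem (hJ (⁅a, m' - J a'⁆ + ⁅m - J a, a'⁆)) (hJk _ h2)
    rw [map_sub] at h3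
    convert h3 using 1
    abel
  · intro h v w
    -- The vectors v - iJv lie in Z₊. The second membership condition for the bracket of two of them
    -- is the torsion condition, up to sign and an element of Ran(J² + 1).
    have hmem : ∀ v : L, (1 : ℂ) ⊗ₜ[ℝ] v - Complex.I ⊗ₜ[ℝ] J v ∈
        (k.baseChange ℂ).comap (J.baseChange ℂ - Complex.I • LinearMap.id) := by
      intro v
      rw [mem_comap_baseChange_iff]
      have := k.neg_mem (hJ v)
      rw [neg_add, ← sub_eq_add_neg] at this
      simpa using this
    have h1 := h _ (hmem v) _ (hmem w)
    rw [mem_comap_baseChange_iff, tensorRe_lie, tensorIm_lie] at h1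
    have h2 := k.neg_mem (k.add_mem h1.2 (hJ ⁅v, w⁆))
    convert h2 using 1
    simp [-lie_skew]
    abel

end LieAlgebra

/-! ### Torsion of the induced structure through left-invariant fields -/

section Torsion

open VectorField

variable {E : Type*} [NormedAddCommGroup E] [NormedSpace ℝ E] [CompleteSpace E]
  {F : Type*} [NormedAddCommGroup F] [NormedSpace ℝ F] [CompleteSpace F]
  {Q : Type*} [NormedAddCommGroup Q] [NormedSpace ℝ Q] [CompleteSpace Q]
  {G : Type*} [TopologicalSpace G] [ChartedSpace E G] [Group G] [LieGroup 𝓘(ℝ, E) ∞ G]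
  {K : Subgroup G} [ChartedSpace F K] [ChartedSpace Q (G ⧸ K)]
  [IsManifold 𝓘(ℝ, Q) ∞ (G ⧸ K)]

/-- The composition of `π_{*g}` with the left translation `𝔤 → T_g G`. -/
def mkTranslate (Q : Type*) [NormedAddCommGroup Q] [NormedSpace ℝ Q] (K : Subgroup G)
    [ChartedSpace Q (G ⧸ K)] (g : G) : GroupLieAlgebra 𝓘(ℝ, E) G →L[ℝ] Q :=
  (mfderiv 𝓘(ℝ, E) 𝓘(ℝ, Q) (fun g : G => (g : G ⧸ K)) g : E →L[ℝ] Q).comp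
    (mfderiv 𝓘(ℝ, E) 𝓘(ℝ, E) (fun z : G => g * z) 1 : E →L[ℝ] E)

omit [CompleteSpace E] [CompleteSpace Q] [LieGroup 𝓘(ℝ, E) ∞ G] [IsManifold 𝓘(ℝ, Q) ∞ (G ⧸ K)] in
theorem mkTranslate_one (v : GroupLieAlgebra 𝓘(ℝ, E) G) :
    mkTranslate Q K (1 : G) v = mfderiv 𝓘(ℝ, E) 𝓘(ℝ, Q) (fun g : G => (g : G ⧸ K)) 1 v := by
  have h : ∀ f : G → G, f = id → ∀ w : E, (mfderiv 𝓘(ℝ, E) 𝓘(ℝ, E) f 1 : E →L[ℝ] E) w = w := by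
    rintro _ rfl w
    exact DFunLike.congr_fun (mfderiv_id (I := 𝓘(ℝ, E)) (x := (1 : G))) w
  exact congrArg (mfderiv 𝓘(ℝ, E) 𝓘(ℝ, Q) (fun g : G => (g : G ⧸ K)) 1 : E →L[ℝ] Q)
    (h _ (by ext z; simp) v)

variable {J : GroupLieAlgebra 𝓘(ℝ, E) G →L[ℝ] GroupLieAlgebra 𝓘(ℝ, E) G}
  {N : ∀ p : G ⧸ K, TangentSpace 𝓘(ℝ, Q) p →L[ℝ] TangentSpace 𝓘(ℝ, Q) p}

/-- The Nijenhuis torsion of an induced bundle map is given by the algebraic torsion of `J`. -/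
theorem IsInducedBy.nijenhuisTorsion_eq (hGK : IsHomogeneousSpace E Q K) (hN : IsSmoothBundleMap N)
    (hind : IsInducedBy N J) {X Y : ∀ p : G ⧸ K, TangentSpace 𝓘(ℝ, Q) p}
    (hX : IsSmoothVectorField X) (hY : IsSmoothVectorField Y) {g : G}
    {v w : GroupLieAlgebra 𝓘(ℝ, E) G} (hXv : X (g : G ⧸ K) = mkTranslate Q K g v)
    (hYw : Y (g : G ⧸ K) = mkTranslate Q K g w) :
    nijenhuisTorsion N X Y (g : G ⧸ K) =
      mkTranslate Q K g (J ⁅J v, w⁆ + J ⁅v, J w⁆ - ⁅J v, J w⁆ - J (J ⁅v, w⁆)) := by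
  have hbr : ∀ a b : GroupLieAlgebra 𝓘(ℝ, E) G,
      (mlieBracket 𝓘(ℝ, E) (mulInvariantVectorField a) (mulInvariantVectorField b) g :
        TangentSpace 𝓘(ℝ, E) g) = mulInvariantVectorField ⁅a, b⁆ g := fun a b =>
    (congrFun (mulInvariantVector_mlieBracket a b) g).symm
  have hrel := fun (v : GroupLieAlgebra 𝓘(ℝ, E) G) (g : G) =>
    hind.mfderiv_mulInvariantVectorField hGK v g
  have h := nijenhuisTorsion_of_related (x := g) hGK.smooth_mk hN
    (mdifferentiableAt_mulInvariantVectorField v) (mdifferentiableAt_mulInvariantVectorField (J v))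
    (mdifferentiableAt_mulInvariantVectorField w) (mdifferentiableAt_mulInvariantVectorField (J w))
    (hrel v) (hrel w) hX hY hXv hYw
  rw [hbr, hbr, hbr, hbr, ← hrel, ← hrel, ← hrel, ← hrel] at h
  refine h.trans ?_
  rw [map_sub, map_sub, map_add]
  rfl

/-- The infinitesimal form of the compatibility of J with Ad_K. The left-invariant field of u is
vertical, so bracketing with it commutes with the operator after projection. -/
theorem IsInducedBy.lie_sub_mem (hGK : IsHomogeneousSpace E Q K)
    (hK : IsBanachLieSubgroup (E := E) (F := F) K) (hN : IsSmoothBundleMap N)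
    (hind : IsInducedBy N J) {u : GroupLieAlgebra 𝓘(ℝ, E) G} (hu : u ∈ subgroupLieAlgebra E F K)
    (w : GroupLieAlgebra 𝓘(ℝ, E) G) : ⁅u, J w⁆ - J ⁅u, w⁆ ∈ subgroupLieAlgebra E F K := by
  apply hGK.mem_subgroupLieAlgebra hK
  have h := mfderiv_mlieBracket_of_vertical (x := (1 : G)) hGK.smooth_mk hN
    (mdifferentiableAt_mulInvariantVectorField u) (mdifferentiableAt_mulInvariantVectorField w)
    (mdifferentiableAt_mulInvariantVectorField (J w))
    (hGK.mfderiv_mulInvariantVectorField_eq_zero hK hu)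
    (fun g => hind.mfderiv_mulInvariantVectorField hGK w g)
  have h' := h.trans (hind.at_base ⁅u, w⁆)
  rw [map_sub, sub_eq_zero]
  exact h'

/-- The field of w is vertical, so it is related to the zero field through any N. The
vertical-bracket lemma with W = 0 then shows that the bracket projects to zero. -/
theorem IsHomogeneousSpace.lie_mem (hGK : IsHomogeneousSpace E Q K)
    (hK : IsBanachLieSubgroup (E := E) (F := F) K) (hN : IsSmoothBundleMap N)
    {u w : GroupLieAlgebra 𝓘(ℝ, E) G} (hu : u ∈ subgroupLieAlgebra E F K)
    (hw : w ∈ subgroupLieAlgebra E F K) : ⁅u, w⁆ ∈ subgroupLieAlgebra E F K := by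
  apply hGK.mem_subgroupLieAlgebra hK
  have h := mfderiv_mlieBracket_of_vertical (x := (1 : G)) hGK.smooth_mk hN
    (mdifferentiableAt_mulInvariantVectorField u) (mdifferentiableAt_mulInvariantVectorField 0)
    (mdifferentiableAt_mulInvariantVectorField w)
    (hGK.mfderiv_mulInvariantVectorField_eq_zero hK hu) (fun g => by
      rw [hGK.mfderiv_mulInvariantVectorField_eq_zero hK hw,
        hGK.mfderiv_mulInvariantVectorField_eq_zero hK (Submodule.zero_mem _), map_zero])
  rw [← GroupLieAlgebra.bracket_def, ← GroupLieAlgebra.bracket_def, lie_zero] at h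
  refine h.trans ?_
  rw [map_zero, map_zero]

end Torsion

end

/-! ### The integrability criterion -/

theorem theorem4p4
    {E : Type*} [NormedAddCommGroup E] [NormedSpace ℝ E] [CompleteSpace E]
    {F : Type*} [NormedAddCommGroup F] [NormedSpace ℝ F] [CompleteSpace F]
    {Q : Type*} [NormedAddCommGroup Q] [NormedSpace ℝ Q] [CompleteSpace Q]
    {G : Type*} [TopologicalSpace G] [ChartedSpace E G] [Group G] [LieGroup 𝓘(ℝ, E) ∞ G]
    (K : Subgroup G) [ChartedSpace F K] (hK : IsBanachLieSubgroup (E := E) (F := F) K)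
    [ChartedSpace Q (G ⧸ K)] [IsManifold 𝓘(ℝ, Q) ∞ (G ⧸ K)] (hGK : IsHomogeneousSpace E Q K)
    (J : GroupLieAlgebra 𝓘(ℝ, E) G →L[ℝ] GroupLieAlgebra 𝓘(ℝ, E) G)
    (hJ : IsAdmissibleComplex (F := F) K J)
    (𝒥 : ∀ p : G ⧸ K, TangentSpace 𝓘(ℝ, Q) p →L[ℝ] TangentSpace 𝓘(ℝ, Q) p)
    (h𝒥 : IsHomogeneousAlmostComplex 𝒥) (hind : IsInducedBy 𝒥 J) :
    IsNijenhuis 𝒥 ↔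
      ∀ v ∈ zPlus (F := F) K J, ∀ w ∈ zPlus (F := F) K J, ⁅v, w⁆ ∈ zPlus (F := F) K J := by
  have hN := h𝒥.smooth
  refine Iff.trans ?_ (lie_mem_comap_baseChange_iff (subgroupLieAlgebra E F K) J.toLinearMap
    hJ.map_mem hJ.sq_add_one_mem (fun u hu w => hind.lie_sub_mem hGK hK hN hu w)
    (fun u hu w hw => hGK.lie_mem hK hN hu hw))
  constructor
  -- Testing at p₀ on fundamental fields suffices, since they take the values π_{*1} v and π_{*1} w
  -- there.
  · intro h v w
    apply hGK.mem_subgroupLieAlgebra hK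
    have h1 := hind.nijenhuisTorsion_eq (g := 1) hGK hN
      (hGK.isSmoothVectorField_fundamentalVectorField v)
      (hGK.isSmoothVectorField_fundamentalVectorField w)
      ((IsHomogeneousSpace.fundamentalVectorField_one v).trans (mkTranslate_one (Q := Q) (K := K) v).symm)
      ((IsHomogeneousSpace.fundamentalVectorField_one w).trans (mkTranslate_one (Q := Q) (K := K) w).symm)
    have h2 := h _ _ (hGK.isSmoothVectorField_fundamentalVectorField v)
      (hGK.isSmoothVectorField_fundamentalVectorField w) ((1 : G) : G ⧸ K)
    exact (mkTranslate_one (Q := Q) (K := K) _).symm.trans (h1.symm.trans h2)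
  · intro h X Y hX hY p
    obtain ⟨g, rfl⟩ := QuotientGroup.mk_surjective p
    -- Only the values of X and Y at gK matter, and each is the projection of a left-invariant field
    -- at g.
    obtain ⟨v, hv⟩ := hGK.exists_mulInvariantVectorField g (X g)
    obtain ⟨w, hw⟩ := hGK.exists_mulInvariantVectorField g (Y g)
    refine (hind.nijenhuisTorsion_eq hGK hN hX hY hv hw).trans ?_
    exact hGK.mfderiv_mulInvariantVectorField_eq_zero hK (h v w) g
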